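/- Let $n\ge 0$ and $d\ge 2$ be integers and let $k=(k_1,\dots,k_{n+1})$ be integers, each coprime to $d$. Let $F_{n+1}$ be the free group on $x_1,\dots,x_{n+1}$. Let $B_{n+1}$ be the braid group with standard generators $s_1,\dots,s_n$, acting on $F_{n+1}$ by Artin's formulae $s_i(x_i)=x_ix_{i+1}x_i^{-1}$, $s_i(x_{i+1})=x_i$, $s_i(x_j)=x_j$ for $j\ne i,i+1$, and let $P_{n+1}=\ker(B_{n+1}\to S_{n+1})$ be the pure braid group. Let $K_0(k,d)$ be the kernel of the homomorphism $F_{n+1}\to \mathbb Z/d\mathbb Z=q^{\mathbb Z}/q^{d\mathbb Z}$, $x_i\mapsto q^{k_i}$. The group $P_{n+1}$ preserves $K_0(k,d)$, and conjugation in $F_{n+1}$ induces an action of $\mathbb Z/d\mathbb Z$ on $V_0=K_0(k,d)^{ab}\otimes\mathbb Q$ which commutes with $P_{n+1}$. Hence $P_{n+1}$ acts $R_d$-linearly on $$V_0^{ni}=V_0/(1+q+\cdots+q^{d-1})V_0,\qquad R_d=\mathbb Q[q]/(1+q+\cdots+q^{d-1}).$$ Let $R=\mathbb Z[X_1^{\pm1},\dots,X_{n+1}^{\pm1}]$,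 the group ring of $F_{n+1}^{ab}$, with field of fractions $\Omega$, and consider the homomorphism $F_{n+1}\to R^{n+1}\rtimes F_{n+1}^{ab}$, $x_i\mapsto(e_i,X_i)$, where $e_1,\dots,e_{n+1}$ is the standard basis of $R^{n+1}$. The Gassner representation of $P_{n+1}$ on $R^{n+1}$ is the $R$-linear action for which $p(e_i)$ is the $R^{n+1}$-component of the image of $p(x_i)$. Put $v_i=(1-X_i)^{-1}e_i$ and $\varepsilon_i=v_i-v_{i+1}$ in $\Omega^{n+1}$. The reduced Gassner representation is the action of $P_{n+1}$ on the free $R$-module $W=\bigoplus_{i=1}^nR\varepsilon_i\subset\Omega^{n+1}$. For units $t_1,\dots,t_{n+1}$ of a commutative ring $A$, its specialisation at $X_i\mapsto t_i$ is the resulting representation on $A^n=\bigoplus_i A\varepsilon_i$. For $e\ge 2$ let $\omega_e$ be a primitive $e$-th root of unity, $E_e=\mathbb Q(\omega_e)$, and let $g_n(k,e)$ be the specialisation at $X_i\mapsto\omega_e^{k_i}$, on $E_e^n$. Then: 1. $V_0^{ni}$ is a free $R_d$-module of rank $n$. 2. As a representation of $P_{n+1}$ over $R_d$, $V_0^{ni}$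 is isomorphic to the reduced Gassner representation specialised at $X_i\mapsto q^{k_i}\in R_d$. 3. There is an isomorphism of representations of $P_{n+1}$ over $\mathbb Q$ $$V_0^{ni}\;\cong\;\bigoplus_{e\mid d,\ e\ge2}g_n(k,e),$$ under which $q$ acts on the summand $g_n(k,e)$ as multiplication by $\omega_e$. -/

import Mathlib

open Polynomial

noncomputable section

namespace PureBraid

/-! ### Braid groups, pure braid groups and Artin's action on the free group -/

/-- The relators of the braid group on `n + 1` strands, on generators `s_i`, `i : Fin n`. -/
def braidRels (n : ℕ) : Set (FreeGroup (Fin n)) :=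
  {r | ∃ i j : Fin n, (i : ℕ) + 2 ≤ j ∧
      r = (FreeGroup.of i * FreeGroup.of j) * (FreeGroup.of j * FreeGroup.of i)⁻¹} ∪
  {r | ∃ i j : Fin n, (i : ℕ) + 1 = j ∧
      r = (FreeGroup.of i * FreeGroup.of j * FreeGroup.of i) *
        (FreeGroup.of j * FreeGroup.of i * FreeGroup.of j)⁻¹}

/-- The braid group `B_{n+1}` on `n + 1` strands. -/
abbrev BraidGroup (n : ℕ) : Type := PresentedGroup (braidRels n)

/-- A map on the generators that satisfies the braid relations extends to `B_{n+1}`. -/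
def braidLift {n : ℕ} {G : Type} [Group G] (f : Fin n → G)
    (hcomm : ∀ i j : Fin n, (i : ℕ) + 2 ≤ j → f i * f j = f j * f i)
    (hbraid : ∀ i j : Fin n, (i : ℕ) + 1 = j → f i * f j * f i = f j * f i * f j) :
    BraidGroup n →* G :=
  PresentedGroup.toGroup (f := f) (by
    rintro r (⟨i, j, hij, rfl⟩ | ⟨i, j, hij, rfl⟩)
    · simp only [map_mul, map_inv, FreeGroup.lift_apply_of]
      rw [hcomm i j hij, mul_inv_cancel]
    · simp only [map_mul, map_inv, FreeGroup.lift_apply_of]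
      rw [hbraid i j hij, mul_inv_cancel])

/-- The endomorphism `a ↦ a b a⁻¹`, `b ↦ a` of a free group fixing all the other generators. -/
def artinHom {α : Type} [DecidableEq α] (a b : α) : FreeGroup α →* FreeGroup α :=
  FreeGroup.lift fun j =>
    if j = a then FreeGroup.of a * FreeGroup.of b * (FreeGroup.of a)⁻¹
    else if j = b then FreeGroup.of a else FreeGroup.of j

/-- The inverse of `artinHom a b` for `a ≠ b`. -/
def artinInv {α : Type} [DecidableEq α] (a b : α) : FreeGroup α →* FreeGroup α :=
  FreeGroup.lift fun j =>
    if j = a then FreeGroup.of b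
    else if j = b then (FreeGroup.of b)⁻¹ * FreeGroup.of a * FreeGroup.of b else FreeGroup.of j

/-- The automorphism `a ↦ a b a⁻¹`, `b ↦ a` of a free group fixing all the other generators. -/
def artinAut {α : Type} [DecidableEq α] (a b : α) (hab : a ≠ b) : MulAut (FreeGroup α) :=
  MonoidHom.toMulEquiv (artinHom a b) (artinInv a b)
    (by
      ext j
      by_cases h1 : j = a
      · subst h1; simp [artinHom, artinInv, hab.symm, mul_assoc]
      · by_cases h2 : j = b
        · subst h2; simp [artinHom, artinInv, h1]
        · simp [artinHom, artinInv, h1, h2])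
    (by
      ext j
      by_cases h1 : j = a
      · subst h1; simp [artinHom, artinInv, hab.symm]
      · by_cases h2 : j = b
        · subst h2; simp [artinHom, artinInv, h1, mul_assoc]
        · simp [artinHom, artinInv, h1, h2])

theorem artinAut_of {α : Type} [DecidableEq α] (a b : α) (hab : a ≠ b) (j : α) :
    artinAut a b hab (FreeGroup.of j) =
      if j = a then FreeGroup.of a * FreeGroup.of b * (FreeGroup.of a)⁻¹
      else if j = b then FreeGroup.of a else FreeGroup.of j := by
  simp [artinAut, artinHom]

theorem mulAut_free_ext {α : Type} {f g : MulAut (FreeGroup α)}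
    (h : ∀ j, f (FreeGroup.of j) = g (FreeGroup.of j)) : f = g := by
  have : f.toMonoidHom = g.toMonoidHom := FreeGroup.ext_hom _ _ h
  exact MulEquiv.toMonoidHom_injective this

theorem castSucc_ne_succ {n : ℕ} (i : Fin n) : i.castSucc ≠ i.succ := by
  intro h
  have := congrArg Fin.val h
  simp at this

theorem artinAut_comm {α : Type} [DecidableEq α] {a b c e : α} (h5 : a ≠ b) (h6 : c ≠ e)
    (h1 : a ≠ c) (h2 : a ≠ e) (h3 : b ≠ c) (h4 : b ≠ e) (l : α) :
    (artinAut a b h5 * artinAut c e h6) (FreeGroup.of l) =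
      (artinAut c e h6 * artinAut a b h5) (FreeGroup.of l) := by
  simp only [MulAut.mul_apply, artinAut_of]
  by_cases ha : l = a
  · subst ha
    simp [artinAut_of, h1, h2, h3, h4]
  by_cases hb : l = b
  · subst hb
    simp [artinAut_of, h1, h2, h3, h4, h5.symm]
  by_cases hc : l = c
  · subst hc
    simp [artinAut_of, h1.symm, h2.symm, h3.symm, h4.symm]
  by_cases he : l = e
  · subst he
    simp [artinAut_of, h1.symm, h2.symm, h3.symm, h4.symm, h6.symm]
  simp [artinAut_of, ha, hb, hc, he]

theorem artinAut_braid {α : Type} [DecidableEq α] {a b e : α} (h5 : a ≠ b) (h6 : b ≠ e)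
    (h2 : a ≠ e) (l : α) :
    (artinAut a b h5 * artinAut b e h6 * artinAut a b h5) (FreeGroup.of l) =
      (artinAut b e h6 * artinAut a b h5 * artinAut b e h6) (FreeGroup.of l) := by
  simp only [MulAut.mul_apply, artinAut_of]
  by_cases ha : l = a
  · subst ha
    simp [artinAut_of, h2, h5, h2.symm, h5.symm, h6.symm, mul_assoc]
  by_cases hb : l = b
  · subst hb
    simp [artinAut_of, h2, h5, h2.symm, h5.symm, h6.symm, mul_assoc]
  by_cases hc : l = e
  · subst hc
    simp [artinAut_of, h2, h5, h2.symm, h5.symm, h6.symm]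
  simp [artinAut_of, ha, hb, hc]

/-- Artin's action of the braid group on the free group `F_{n+1}`:
`s_i (x_i) = x_i x_{i+1} x_i⁻¹`, `s_i (x_{i+1}) = x_i`, `s_i (x_j) = x_j` otherwise. -/
def artinAction (n : ℕ) : BraidGroup n →* MulAut (FreeGroup (Fin (n + 1))) :=
  braidLift (fun i => artinAut i.castSucc i.succ (castSucc_ne_succ i))
    (by
      intro i j hij
      apply mulAut_free_ext
      intro l
      have h1 : i.castSucc ≠ j.castSucc := by rw [Ne, Fin.ext_iff]; simp; omega
      have h2 : i.castSucc ≠ j.succ := by rw [Ne, Fin.ext_iff]; simp; omega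
      have h3 : i.succ ≠ j.castSucc := by rw [Ne, Fin.ext_iff]; simp; omega
      have h4 : i.succ ≠ j.succ := by rw [Ne, Fin.ext_iff]; simp; omega
      have h5 := castSucc_ne_succ i
      have h6 := castSucc_ne_succ j
      exact artinAut_comm h5 h6 h1 h2 h3 h4 l)
    (by
      intro i j hij
      apply mulAut_free_ext
      intro l
      have h1 : j.castSucc = i.succ := by rw [Fin.ext_iff]; simp; omega
      have h2 : i.castSucc ≠ j.succ := by rw [Ne, Fin.ext_iff]; simp; omega
      have h5 := castSucc_ne_succ i
      have h6 := castSucc_ne_succ j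
      simp only [h1] at h6 ⊢
      exact artinAut_braid h5 h6 h2 l)

/-- The homomorphism `B_{n+1} → S_{n+1}` sending `s_i` to the transposition `(i, i+1)`. -/
def braidPerm (n : ℕ) : BraidGroup n →* Equiv.Perm (Fin (n + 1)) :=
  braidLift (fun i => Equiv.swap i.castSucc i.succ)
    (by
      intro i j hij
      have h1 : i.castSucc ≠ j.castSucc := by rw [Ne, Fin.ext_iff]; simp; omega
      have h2 : i.castSucc ≠ j.succ := by rw [Ne, Fin.ext_iff]; simp; omega
      have h3 : i.succ ≠ j.castSucc := by rw [Ne, Fin.ext_iff]; simp; omega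
      have h4 : i.succ ≠ j.succ := by rw [Ne, Fin.ext_iff]; simp; omega
      generalize i.castSucc = a at *
      generalize i.succ = b at *
      generalize j.castSucc = c at *
      generalize j.succ = e at *
      ext l
      simp only [Equiv.Perm.mul_apply, Equiv.swap_apply_def]
      congr 1
      split_ifs <;> simp_all)
    (by
      intro i j hij
      have h1 : j.castSucc = i.succ := by rw [Fin.ext_iff]; simp; omega
      have h2 : i.castSucc ≠ j.succ := by rw [Ne, Fin.ext_iff]; simp; omega
      have h5 := castSucc_ne_succ i
      have h6 := castSucc_ne_succ j
      simp only [h1] at h6 ⊢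
      generalize i.castSucc = a at *
      generalize i.succ = b at *
      generalize j.succ = e at *
      ext l
      simp only [Equiv.Perm.mul_apply, Equiv.swap_apply_def]
      congr 1
      split_ifs <;> simp_all)

/-- The pure braid group `P_{n+1}`. -/
abbrev pureBraidGroup (n : ℕ) : Subgroup (BraidGroup n) := (braidPerm n).ker

/-- Each braid carries each free generator to a conjugate of a free generator. -/
theorem artinAction_of (n : ℕ) (b : BraidGroup n) : ∀ j : Fin (n + 1),
    ∃ w : FreeGroup (Fin (n + 1)), artinAction n b (FreeGroup.of j) =
      w * FreeGroup.of (braidPerm n b j) * w⁻¹ := by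
  have hb : b ∈ Subgroup.closure (Set.range (PresentedGroup.of (rels := braidRels n))) := by
    rw [PresentedGroup.closure_range_of]; trivial
  induction hb using Subgroup.closure_induction with
  | mem x hx =>
    obtain ⟨i, rfl⟩ := hx
    intro j
    have e1 : artinAction n (PresentedGroup.of i) =
      artinAut i.castSucc i.succ (castSucc_ne_succ i) := by
      rw [artinAction, braidLift, PresentedGroup.toGroup.of]
    have e2 : braidPerm n (PresentedGroup.of i) =
      Equiv.swap i.castSucc i.succ := by
      rw [braidPerm, braidLift, PresentedGroup.toGroup.of]
    rw [e1, e2, artinAut_of]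
    by_cases h1 : j = i.castSucc
    · subst h1
      exact ⟨FreeGroup.of i.castSucc, by simp⟩
    · by_cases h2 : j = i.succ
      · subst h2
        exact ⟨1, by simp [(castSucc_ne_succ i).symm]⟩
      · exact ⟨1, by simp [h1, h2, Equiv.swap_apply_of_ne_of_ne h1 h2]⟩
  | one => intro j; exact ⟨1, by simp⟩
  | mul x y _ _ hx hy =>
    intro j
    obtain ⟨w, hw⟩ := hy j
    obtain ⟨u, hu⟩ := hx (braidPerm n y j)
    exact ⟨artinAction n x w * u, by
      rw [map_mul, MulAut.mul_apply, hw, map_mul, map_mul, map_inv, hu]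
      simp [mul_assoc]⟩
  | inv x _ hx =>
    intro j
    obtain ⟨w, hw⟩ := hx ((braidPerm n x)⁻¹ j)
    refine ⟨(artinAction n x⁻¹ w)⁻¹, ?_⟩
    have h2 := congrArg (artinAction n x⁻¹) hw
    rw [← MulAut.mul_apply, ← map_mul, inv_mul_cancel, map_one, MulAut.one_apply] at h2
    rw [← Equiv.Perm.mul_apply, mul_inv_cancel, Equiv.Perm.one_apply] at h2
    rw [map_inv (braidPerm n), h2]
    simp [mul_assoc]

/-- The action of the pure braid group on the free group. -/
def pureAction (n : ℕ) : pureBraidGroup n →* MulAut (FreeGroup (Fin (n + 1))) :=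
  (artinAction n).comp (pureBraidGroup n).subtype

theorem pureAction_of (n : ℕ) (p : pureBraidGroup n) (j : Fin (n + 1)) :
    ∃ w : FreeGroup (Fin (n + 1)), pureAction n p (FreeGroup.of j) =
      w * FreeGroup.of j * w⁻¹ := by
  obtain ⟨w, hw⟩ := artinAction_of n p j
  have hp : braidPerm n (p : BraidGroup n) = 1 := p.2
  rw [hp] at hw
  exact ⟨w, hw⟩

/-- The pure braid group acts trivially on every abelian quotient of the free group. -/
theorem pureAction_trivial {n : ℕ} {A : Type} [CommGroup A]
    (f : FreeGroup (Fin (n + 1)) →* A) (p : pureBraidGroup n) (x : FreeGroup (Fin (n + 1))) :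
    f (pureAction n p x) = f x := by
  have : f.comp (pureAction n p).toMonoidHom = f := by
    ext j
    obtain ⟨w, hw⟩ := pureAction_of n p j
    simp [hw]
  exact DFunLike.congr_fun this x

/-! ### The Gassner representation -/

/-- `F_{n+1}^{ab} = ℤ^{n+1}`, written multiplicatively. -/
abbrev Lattice (n : ℕ) : Type := Multiplicative (Fin (n + 1) → ℤ)

/-- The ring `R = ℤ[X_1^{±1}, …, X_{n+1}^{±1}]`, the group ring of `F_{n+1}^{ab}`. -/
abbrev Laurent (n : ℕ) : Type := MonoidAlgebra ℤ (Lattice n)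

/-- The class of the generator `x_i` in `F_{n+1}^{ab}`. -/
def latticeGen {n : ℕ} (i : Fin (n + 1)) : Lattice n := Multiplicative.ofAdd (Pi.single i 1)

/-- The variable `X_i` of the Laurent polynomial ring. -/
def varX {n : ℕ} (i : Fin (n + 1)) : Laurent n := MonoidAlgebra.of ℤ _ (latticeGen i)

/-- The action of `F_{n+1}^{ab}` on the additive group `R^{n+1}` by scalar multiplication. -/
def latticeAct (n : ℕ) : Lattice n →* MulAut (Multiplicative (Fin (n + 1) → Laurent n)) where
  toFun g :=
    { toFun := fun w => Multiplicative.ofAdd (MonoidAlgebra.of ℤ _ g • w.toAdd)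
      invFun := fun w => Multiplicative.ofAdd (MonoidAlgebra.of ℤ _ g⁻¹ • w.toAdd)
      left_inv := fun w => by
        simp only [toAdd_ofAdd, smul_smul, ← map_mul, inv_mul_cancel, map_one, one_smul, ofAdd_toAdd]
      right_inv := fun w => by
        simp only [toAdd_ofAdd, smul_smul, ← map_mul, mul_inv_cancel, map_one, one_smul, ofAdd_toAdd]
      map_mul' := fun w w' => by
        simp only [toAdd_mul, smul_add, ofAdd_add] }
  map_one' := by
    ext1 w
    change Multiplicative.ofAdd (MonoidAlgebra.of ℤ _ (1 : Lattice n) • w.toAdd) = w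
    rw [map_one, one_smul, ofAdd_toAdd]
  map_mul' g h := by
    ext1 w
    change Multiplicative.ofAdd (MonoidAlgebra.of ℤ _ (g * h) • w.toAdd) =
      Multiplicative.ofAdd (MonoidAlgebra.of ℤ _ g • MonoidAlgebra.of ℤ _ h • w.toAdd)
    rw [map_mul, smul_smul]

theorem latticeAct_apply {n : ℕ} (g : Lattice n)
    (w : Multiplicative (Fin (n + 1) → Laurent n)) :
    latticeAct n g w = Multiplicative.ofAdd (MonoidAlgebra.of ℤ _ g • w.toAdd) := rfl

/-- The homomorphism `F_{n+1} → R^{n+1} ⋊ F_{n+1}^{ab}`, `x_i ↦ (e_i, X_i)`. -/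
def magnus (n : ℕ) : FreeGroup (Fin (n + 1)) →*
    Multiplicative (Fin (n + 1) → Laurent n) ⋊[latticeAct n] Lattice n :=
  FreeGroup.lift fun i => ⟨Multiplicative.ofAdd (Pi.single i 1), latticeGen i⟩

/-- The vector component of the image of `x` in `R^{n+1} ⋊ F_{n+1}^{ab}`. -/
def vecPart {n : ℕ} (x : FreeGroup (Fin (n + 1))) : Fin (n + 1) → Laurent n :=
  (magnus n x).left.toAdd

/-- The class of `x` in `F_{n+1}^{ab}`, as a unit monomial of `R`. -/
def monoPart {n : ℕ} (x : FreeGroup (Fin (n + 1))) : Laurent n :=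
  MonoidAlgebra.of ℤ _ (magnus n x).right

theorem vecPart_of {n : ℕ} (i : Fin (n + 1)) :
    vecPart (FreeGroup.of i) = Pi.single i 1 := by
  simp [vecPart, magnus]

theorem monoPart_of {n : ℕ} (i : Fin (n + 1)) : monoPart (FreeGroup.of i) = varX i := by
  simp [monoPart, magnus, varX]

theorem vecPart_one {n : ℕ} : vecPart (1 : FreeGroup (Fin (n + 1))) = 0 := by
  simp [vecPart]

theorem monoPart_one {n : ℕ} : monoPart (1 : FreeGroup (Fin (n + 1))) = 1 := by
  simp only [monoPart, map_one, SemidirectProduct.one_right]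

theorem vecPart_mul {n : ℕ} (x y : FreeGroup (Fin (n + 1))) :
    vecPart (x * y) = vecPart x + monoPart x • vecPart y := by
  simp only [vecPart, monoPart, map_mul, SemidirectProduct.mul_left, latticeAct_apply, toAdd_mul,
    toAdd_ofAdd]

theorem monoPart_mul {n : ℕ} (x y : FreeGroup (Fin (n + 1))) :
    monoPart (x * y) = monoPart x * monoPart y := by
  simp only [monoPart, map_mul, SemidirectProduct.mul_right]

theorem monoPart_pure {n : ℕ} (p : pureBraidGroup n) (x : FreeGroup (Fin (n + 1))) :
    monoPart (pureAction n p x) = monoPart x := by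
  have := pureAction_trivial
    ((SemidirectProduct.rightHom (φ := latticeAct n)).comp (magnus n)) p x
  exact congrArg (MonoidAlgebra.of ℤ _) this

theorem monoPart_inv_mul {n : ℕ} (x : FreeGroup (Fin (n + 1))) :
    monoPart x⁻¹ * monoPart x = 1 := by
  rw [← monoPart_mul, inv_mul_cancel, monoPart_one]

theorem vecPart_inv {n : ℕ} (x : FreeGroup (Fin (n + 1))) :
    vecPart x⁻¹ = -(monoPart x⁻¹ • vecPart x) := by
  have h := vecPart_mul x⁻¹ x
  rw [inv_mul_cancel, vecPart_one] at h
  exact eq_neg_of_add_eq_zero_left h.symm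

theorem vecPart_conj {n : ℕ} (w : FreeGroup (Fin (n + 1))) (j : Fin (n + 1)) :
    vecPart (w * FreeGroup.of j * w⁻¹) =
      (1 - varX j) • vecPart w + monoPart w • Pi.single j 1 := by
  have h := monoPart_inv_mul w
  rw [vecPart_mul, vecPart_mul, vecPart_inv, monoPart_mul, vecPart_of, monoPart_of,
    smul_neg, smul_smul]
  have : monoPart w * varX j * monoPart w⁻¹ = varX j := by
    linear_combination (varX j) * h
  rw [this, sub_smul, one_smul]
  abel

/-- The matrix of the pure braid `p` on `R^{n+1}`: its `i`-th column is the vector component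
of `p (x_i)`, that is `p (x_i) = (p (e_i), X_i)`. -/
def gassnerMatrix {n : ℕ} (p : pureBraidGroup n) :
    Matrix (Fin (n + 1)) (Fin (n + 1)) (Laurent n) :=
  Matrix.of fun j i => vecPart (pureAction n p (FreeGroup.of i)) j

theorem gassnerMatrix_mulVec_single {n : ℕ} (p : pureBraidGroup n) (i : Fin (n + 1)) :
    (gassnerMatrix p).mulVec (Pi.single i 1) = vecPart (pureAction n p (FreeGroup.of i)) := by
  ext1 j
  simp [gassnerMatrix]

theorem gassnerMatrix_mulVec {n : ℕ} (p : pureBraidGroup n) (x : FreeGroup (Fin (n + 1))) :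
    (gassnerMatrix p).mulVec (vecPart x) = vecPart (pureAction n p x) := by
  induction x using FreeGroup.induction_on with
  | C1 => simp [vecPart_one]
  | of i => rw [vecPart_of, gassnerMatrix_mulVec_single]
  | inv_of i hi =>
    rw [map_inv, vecPart_inv, vecPart_inv, Matrix.mulVec_neg, Matrix.mulVec_smul, hi,
      ← map_inv, monoPart_pure]
  | mul x y hx hy =>
    rw [map_mul, vecPart_mul, vecPart_mul, Matrix.mulVec_add, Matrix.mulVec_smul, hx, hy,
      monoPart_pure]

/-- The Gassner representation `G_n(X) : P_{n+1} → GL_{n+1}(R)`. -/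
def gassner (n : ℕ) :
    pureBraidGroup n →* Matrix (Fin (n + 1)) (Fin (n + 1)) (Laurent n) where
  toFun := gassnerMatrix
  map_one' := by
    apply Matrix.ext_of_mulVec_single
    intro i
    rw [gassnerMatrix_mulVec_single, map_one, MulAut.one_apply, vecPart_of, Matrix.one_mulVec]
  map_mul' p q := by
    apply Matrix.ext_of_mulVec_single
    intro i
    rw [← Matrix.mulVec_mulVec, gassnerMatrix_mulVec_single, gassnerMatrix_mulVec_single,
      gassnerMatrix_mulVec, map_mul, MulAut.mul_apply]

/-! ### The reduced Gassner representation -/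

/-- The field of fractions `Ω` of the Laurent polynomial ring. -/
abbrev Omega (n : ℕ) : Type := FractionRing (Laurent n)

theorem one_sub_varX_ne_zero {n : ℕ} (i : Fin (n + 1)) : (1 : Laurent n) - varX i ≠ 0 := by
  intro h
  have h1 : MonoidAlgebra.of ℤ (Lattice n) 1 = MonoidAlgebra.of ℤ (Lattice n) (latticeGen i) := by
    rw [map_one]; exact sub_eq_zero.mp h
  have h2 := MonoidAlgebra.of_injective h1
  have h3 := congrFun (congrArg Multiplicative.toAdd h2) i
  simp [latticeGen] at h3

/-- The vector `v_i = (1 - X_i)⁻¹ e_i` of `Ω^{n+1}`. -/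
def vVec {n : ℕ} (i : Fin (n + 1)) : Fin (n + 1) → Omega n :=
  Pi.single i (algebraMap (Laurent n) (Omega n) (1 - varX i))⁻¹

/-- The vector `ε_i = v_i - v_{i+1}` of `Ω^{n+1}`. -/
def epsVec {n : ℕ} (i : Fin n) : Fin (n + 1) → Omega n := vVec i.castSucc - vVec i.succ

/-- The action of the pure braid group on `Ω^{n+1}`, extending the Gassner representation. -/
def gassnerOmega (n : ℕ) : Representation (Laurent n) (pureBraidGroup n)
    (Fin (n + 1) → Omega n) where
  toFun p := (Matrix.toLin' ((gassner n p).map (algebraMap (Laurent n) (Omega n)))).restrictScalars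
    (Laurent n)
  map_one' := by
    refine LinearMap.ext fun w => ?_
    simp
  map_mul' p q := by
    refine LinearMap.ext fun w => ?_
    simp [Matrix.map_mul]

/-- The `R`-submodule `W = ⊕ R ε_i` of `Ω^{n+1}`. -/
def reducedModule (n : ℕ) : Submodule (Laurent n) (Fin (n + 1) → Omega n) :=
  Submodule.span (Laurent n) (Set.range epsVec)

/-- The image in `Ω^{n+1}` of a vector of `R^{n+1}`. -/
def toOmega {n : ℕ} : (Fin (n + 1) → Laurent n) →ₗ[Laurent n] (Fin (n + 1) → Omega n) :=
  (Algebra.linearMap (Laurent n) (Omega n)).compLeft (Fin (n + 1))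

theorem algebraMap_ne_zero {n : ℕ} (i : Fin (n + 1)) :
    algebraMap (Laurent n) (Omega n) (1 - varX i) ≠ 0 := by
  rw [Ne, FaithfulSMul.algebraMap_eq_zero_iff]
  exact one_sub_varX_ne_zero i

theorem one_sub_smul_vVec {n : ℕ} (i : Fin (n + 1)) :
    (1 - varX i : Laurent n) • vVec i = toOmega (Pi.single i 1) := by
  have h : algebraMap (Laurent n) (Omega n) (1 - varX i) ≠ 0 := by
    exact algebraMap_ne_zero i
  ext1 j
  by_cases hj : j = i
  · subst hj
    simp only [vVec, toOmega, Pi.smul_apply, Pi.single_eq_same, Algebra.smul_def]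
    rw [mul_inv_cancel₀ h]
    simp
  · simp [vVec, toOmega, hj]

theorem gassnerOmega_toOmega {n : ℕ} (p : pureBraidGroup n) (w : Fin (n + 1) → Laurent n) :
    gassnerOmega n p (toOmega w) = toOmega ((gassnerMatrix p).mulVec w) := by
  ext1 j
  simp [gassnerOmega, toOmega, gassner, Matrix.mulVec, dotProduct]

theorem omega_smul_cancel {n : ℕ} (i : Fin (n + 1)) {a b : Fin (n + 1) → Omega n}
    (h : (1 - varX i : Laurent n) • a = (1 - varX i : Laurent n) • b) : a = b := by
  have h0 : algebraMap (Laurent n) (Omega n) (1 - varX i) ≠ 0 := by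
    exact algebraMap_ne_zero i
  ext1 j
  have := congrFun h j
  simp only [Pi.smul_apply, Algebra.smul_def] at this
  exact mul_left_cancel₀ h0 this

theorem gassnerOmega_vVec {n : ℕ} (p : pureBraidGroup n) (i : Fin (n + 1)) :
    ∃ w : FreeGroup (Fin (n + 1)),
      gassnerOmega n p (vVec i) = toOmega (vecPart w) + monoPart w • vVec i := by
  obtain ⟨w, hw⟩ := pureAction_of n p i
  refine ⟨w, omega_smul_cancel i ?_⟩
  rw [← map_smul, one_sub_smul_vVec, gassnerOmega_toOmega, gassnerMatrix_mulVec_single, hw,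
    vecPart_conj, map_add, map_smul, map_smul, smul_add, ← one_sub_smul_vVec, smul_comm]

theorem vVec_sub_mem {n : ℕ} (i : Fin (n + 1)) : vVec i - vVec 0 ∈ reducedModule n := by
  induction i using Fin.induction with
  | zero => simp
  | succ i ih =>
    have h : epsVec i ∈ reducedModule n := Submodule.subset_span ⟨i, rfl⟩
    have := sub_mem ih h
    simpa [epsVec] using this

theorem vecPart_mem {n : ℕ} (x : FreeGroup (Fin (n + 1))) :
    toOmega (vecPart x) - (1 - monoPart x) • vVec 0 ∈ reducedModule n := by
  induction x using FreeGroup.induction_on with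
  | C1 => simp [vecPart_one, monoPart_one]
  | of i =>
    rw [vecPart_of, monoPart_of, ← one_sub_smul_vVec, ← smul_sub]
    exact Submodule.smul_mem _ _ (vVec_sub_mem i)
  | inv_of i hi =>
    have h := Submodule.smul_mem _ (-monoPart (FreeGroup.of i)⁻¹) hi
    have e := monoPart_inv_mul (FreeGroup.of i)
    rw [vecPart_inv, map_neg, map_smul]
    convert! h using 1
    rw [smul_sub, smul_smul, neg_smul]
    congr 2
    linear_combination -e
  | mul x y hx hy =>
    have h := add_mem hx (Submodule.smul_mem _ (monoPart x) hy)
    rw [vecPart_mul, monoPart_mul, map_add, map_smul]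
    convert! h using 1
    module

theorem reducedModule_stable {n : ℕ} (p : pureBraidGroup n) {w : Fin (n + 1) → Omega n}
    (hw : w ∈ reducedModule n) : gassnerOmega n p w ∈ reducedModule n := by
  have key : ∀ i : Fin (n + 1), gassnerOmega n p (vVec i) - vVec 0 ∈ reducedModule n := by
    intro i
    obtain ⟨w, hw⟩ := gassnerOmega_vVec p i
    have h := add_mem (vecPart_mem w) (Submodule.smul_mem _ (monoPart w) (vVec_sub_mem i))
    rw [hw]
    convert! h using 1
    module
  have hle : reducedModule n ≤ (reducedModule n).comap (gassnerOmega n p) := by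
    refine Submodule.span_le.mpr ?_
    rintro _ ⟨i, rfl⟩
    have h := sub_mem (key i.castSucc) (key i.succ)
    simpa [epsVec] using h
  exact hle hw

/-- The reduced Gassner representation of the pure braid group on the `R`-module `W`. -/
def reducedGassner (n : ℕ) :
    Representation (Laurent n) (pureBraidGroup n) (reducedModule n) where
  toFun p := (gassnerOmega n p).restrict fun _ hw => reducedModule_stable p hw
  map_one' := by
    ext1 w
    apply Subtype.ext
    simp [LinearMap.restrict_apply]
  map_mul' p q := by
    ext1 w
    apply Subtype.ext
    simp [LinearMap.restrict_apply]

theorem epsVec_linearIndependent (n : ℕ) :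
    LinearIndependent (Laurent n) (epsVec : Fin n → Fin (n + 1) → Omega n) := by
  rw [Fintype.linearIndependent_iff]
  intro c hc
  have hne : ∀ j : Fin (n + 1), (algebraMap (Laurent n) (Omega n) (1 - varX j))⁻¹ ≠ 0 := by
    intro j
    apply inv_ne_zero
    exact algebraMap_ne_zero j
  suffices h : ∀ m : ℕ, ∀ i : Fin n, (i : ℕ) = m → c i = 0 from fun i => h i i rfl
  intro m
  induction m with
  | zero =>
    intro i hi
    have h := congrFun hc i.castSucc
    rw [Finset.sum_apply, Finset.sum_eq_single i] at h
    · simp only [epsVec, vVec, Pi.smul_apply, Pi.sub_apply, Pi.single_eq_same,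
        Pi.single_eq_of_ne (castSucc_ne_succ i), sub_zero, Pi.zero_apply, Algebra.smul_def] at h
      simpa using (mul_eq_zero.mp h).resolve_right (hne _)
    · intro j _ hj
      have h1 : i.castSucc ≠ j.castSucc := by simpa using hj.symm
      have h2 : i.castSucc ≠ j.succ := by rw [Ne, Fin.ext_iff]; simp; omega
      simp [epsVec, vVec, h1, h2]
    · simp
  | succ m ih =>
    intro i hi
    have h := congrFun hc i.castSucc
    rw [Finset.sum_apply, Finset.sum_eq_single i] at h
    · simp only [epsVec, vVec, Pi.smul_apply, Pi.sub_apply, Pi.single_eq_same,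
        Pi.single_eq_of_ne (castSucc_ne_succ i), sub_zero, Pi.zero_apply, Algebra.smul_def] at h
      simpa using (mul_eq_zero.mp h).resolve_right (hne _)
    · intro j _ hj
      by_cases hjm : (j : ℕ) = m
      · simp [ih j hjm]
      have h1 : i.castSucc ≠ j.castSucc := by simpa using hj.symm
      have h2 : i.castSucc ≠ j.succ := by rw [Ne, Fin.ext_iff]; simp; omega
      simp [epsVec, vVec, h1, h2]
    · simp

/-- The basis `ε_1, …, ε_n` of `W`. -/
def epsBasis (n : ℕ) : Module.Basis (Fin n) (Laurent n) (reducedModule n) :=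
  Module.Basis.span (epsVec_linearIndependent n)

/-- The reduced Gassner representation `g_n(X) : P_{n+1} → GL_n(R)` in the basis `ε_i`. -/
def reducedGassnerMatrix (n : ℕ) :
    pureBraidGroup n →* Matrix (Fin n) (Fin n) (Laurent n) :=
  (LinearMap.toMatrixAlgEquiv (epsBasis n)).toMonoidHom.comp (reducedGassner n)

/-- The ring homomorphism `R → A` with `X_i ↦ t_i`. -/
def specialise {n : ℕ} {A : Type} [CommRing A] (t : Fin (n + 1) → Aˣ) : Laurent n →+* A :=
  (MonoidAlgebra.lift ℤ A (Lattice n)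
    { toFun := fun m => ((∏ i, t i ^ m.toAdd i : Aˣ) : A)
      map_one' := by simp
      map_mul' := fun a b => by
        simp only [toAdd_mul, Pi.add_apply, zpow_add, Finset.prod_mul_distrib, Units.val_mul] }
    : Laurent n →ₐ[ℤ] A).toRingHom

/-- The reduced Gassner representation specialised at `X_i ↦ t_i`, on `A^n = ⊕ A ε_i`. -/
def reducedGassnerAt {n : ℕ} {A : Type} [CommRing A] (t : Fin (n + 1) → Aˣ) :
    Representation A (pureBraidGroup n) (Fin n → A) :=
  (Matrix.toLinAlgEquiv' : Matrix (Fin n) (Fin n) A ≃ₐ[A] _).toMonoidHom.comp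
    ((specialise t).mapMatrix.toMonoidHom.comp (reducedGassnerMatrix n))

instance (e : ℕ) [NeZero e] : IsCyclotomicExtension {e} ℚ (CyclotomicField e ℚ) :=
  CyclotomicField.isCyclotomicExtension e ℚ

/-- A primitive `e`-th root of unity `ω_e` in the cyclotomic field `E_e = ℚ(ω_e)`. -/
def omegaUnit (e : ℕ) [NeZero e] : (CyclotomicField e ℚ)ˣ :=
  Units.mk0 (IsCyclotomicExtension.zeta e ℚ (CyclotomicField e ℚ))
    ((IsCyclotomicExtension.zeta_spec e ℚ (CyclotomicField e ℚ)).ne_zero (NeZero.ne e))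

/-- The representation `g_n(k, e)`: the reduced Gassner representation specialised at
`X_i ↦ ω_e ^ {k_i}`, viewed as a representation over `ℚ` on `E_e^n`. -/
def gassnerAtRoot {n : ℕ} (k : Fin (n + 1) → ℤ) (e : ℕ) [NeZero e] :
    Representation ℚ (pureBraidGroup n) (Fin n → CyclotomicField e ℚ) where
  toFun p := (reducedGassnerAt (fun i => omegaUnit e ^ k i) p).toAddMonoidHom.toRatLinearMap
  map_one' := by rw [map_one]; rfl
  map_mul' p q := by rw [map_mul]; rfl

/-! ### The ring `R_d` -/

/-- The polynomial `1 + q + ⋯ + q^{d-1}`. -/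
def normPoly (d : ℕ) : ℚ[X] := ∑ i ∈ Finset.range d, X ^ i

/-- The ring `R_d = ℚ[q] / (1 + q + ⋯ + q^{d-1})`. -/
abbrev RingRd (d : ℕ) : Type := ℚ[X] ⧸ Ideal.span {normPoly d}

/-- The class `q` in `R_d`. -/
def qElt (d : ℕ) : RingRd d := Ideal.Quotient.mk _ X

theorem qElt_pow (d : ℕ) : qElt d ^ d = 1 := by
  have h : qElt d ^ d - 1 = 0 := by
    rw [qElt, ← map_pow, ← map_one (Ideal.Quotient.mk _), ← map_sub, Ideal.Quotient.eq_zero_iff_mem,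
      Ideal.mem_span_singleton]
    exact ⟨X - 1, (geom_sum_mul X d).symm⟩
  exact sub_eq_zero.mp h

/-- The class `q` as a unit of `R_d`. -/
def qUnit (d : ℕ) [NeZero d] : (RingRd d)ˣ :=
  Units.ofPowEqOne (qElt d) d (qElt_pow d) (NeZero.ne d)

/-! ### The homology of the cyclic covering -/

/-- The first rational homology `K^{ab} ⊗ ℚ` of a group. -/
abbrev H1Q (K : Type) [Group K] : Type := TensorProduct ℤ ℚ (Additive (Abelianization K))

/-- The action of endomorphisms of a group on its first rational homology. -/
def H1Qmap (K : Type) [Group K] : Monoid.End K →* Module.End ℚ (H1Q K) where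
  toFun f := (MonoidHom.toAdditive (Abelianization.map f)).toIntLinearMap.baseChange ℚ
  map_one' := by
    have : (MonoidHom.toAdditive (Abelianization.map (1 : Monoid.End K))).toIntLinearMap =
        LinearMap.id := by
      ext1 a
      exact DFunLike.congr_fun (Abelianization.map_id (G := K)) a.toMul
    rw [this, LinearMap.baseChange_id]
    rfl
  map_mul' f g := by
    have : (MonoidHom.toAdditive (Abelianization.map (f * g))).toIntLinearMap =
        (MonoidHom.toAdditive (Abelianization.map f)).toIntLinearMap ∘ₗ
          (MonoidHom.toAdditive (Abelianization.map g)).toIntLinearMap := by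
      ext1 a
      exact (DFunLike.congr_fun (Abelianization.map_comp (f := g) f) a.toMul).symm
    rw [this, LinearMap.baseChange_comp]
    rfl

/-- An automorphism, as an endomorphism. -/
def autToEnd (K : Type) [Group K] : MulAut K →* Monoid.End K where
  toFun f := f.toMonoidHom
  map_one' := rfl
  map_mul' _ _ := rfl

/-- The homomorphism `F_{n+1} → ℤ/d`, `x_i ↦ q^{k_i}`. -/
def chi {n : ℕ} (k : Fin (n + 1) → ℤ) (d : ℕ) :
    FreeGroup (Fin (n + 1)) →* Multiplicative (ZMod d) :=
  FreeGroup.lift fun i => Multiplicative.ofAdd (k i : ZMod d)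

/-- The group `K_0(k, d)`. -/
abbrev K0 {n : ℕ} (k : Fin (n + 1) → ℤ) (d : ℕ) : Subgroup (FreeGroup (Fin (n + 1))) :=
  (chi k d).ker

/-- The space `V_0 = K_0(k, d)^{ab} ⊗ ℚ`. -/
abbrev V0 {n : ℕ} (k : Fin (n + 1) → ℤ) (d : ℕ) : Type := H1Q (K0 k d)

/-- The action of `F_{n+1}` on `V_0` induced by conjugation. -/
def conjAction {n : ℕ} (k : Fin (n + 1) → ℤ) (d : ℕ) :
    Representation ℚ (FreeGroup (Fin (n + 1))) (V0 k d) :=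
  (H1Qmap (K0 k d)).comp
    ((autToEnd (K0 k d)).comp MulAut.conjNormal)

theorem conjAction_of_mem {n : ℕ} (k : Fin (n + 1) → ℤ) (d : ℕ)
    (x : FreeGroup (Fin (n + 1))) (hx : x ∈ K0 k d) : conjAction k d x = 1 := by
  have h : (MonoidHom.toAdditive (Abelianization.map
      ((autToEnd (K0 k d)) (MulAut.conjNormal x)))).toIntLinearMap =
      LinearMap.id := by
    ext1 a
    obtain ⟨y, hy⟩ := QuotientGroup.mk_surjective a.toMul
    have ha : a = Additive.ofMul (Abelianization.of y) := congrArg Additive.ofMul hy.symm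
    subst ha
    change Additive.ofMul (Abelianization.of (MulAut.conjNormal x y)) =
      Additive.ofMul (Abelianization.of y)
    have e : MulAut.conjNormal x y = (⟨x, hx⟩ : K0 k d) * y * (⟨x, hx⟩ : K0 k d)⁻¹ := by
      apply Subtype.ext
      simp [MulAut.conjNormal_apply]
    rw [e]
    simp
  change ((MonoidHom.toAdditive (Abelianization.map
      ((autToEnd (K0 k d)) (MulAut.conjNormal x)))).toIntLinearMap).baseChange ℚ = 1
  rw [h, LinearMap.baseChange_id]
  rfl

/-- The conjugation action on `V_0` only depends on the image in `ℤ/d`. -/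
theorem conjAction_congr {n : ℕ} (k : Fin (n + 1) → ℤ) (d : ℕ)
    {x y : FreeGroup (Fin (n + 1))} (h : chi k d x = chi k d y) :
    conjAction k d x = conjAction k d y := by
  have hm : x * y⁻¹ ∈ K0 k d := by
    rw [MonoidHom.mem_ker, map_mul, map_inv, h, mul_inv_cancel]
  have e := conjAction_of_mem k d _ hm
  have : x = x * y⁻¹ * y := by group
  rw [this, map_mul, e, one_mul]

/-- An element `ξ` of `F_{n+1}` with image `q` in `ℤ/d` (when `k_1` is prime to `d`). -/
def xi {n : ℕ} (k : Fin (n + 1) → ℤ) (d : ℕ) : FreeGroup (Fin (n + 1)) :=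
  FreeGroup.of 0 ^ ((k 0 : ZMod d)⁻¹).val

theorem chi_xi {n : ℕ} (k : Fin (n + 1) → ℤ) (d : ℕ) [NeZero d]
    (hk : IsCoprime (k 0) (d : ℤ)) : chi k d (xi k d) = Multiplicative.ofAdd 1 := by
  have hu : IsUnit (k 0 : ZMod d) := by
    obtain ⟨a, b, hab⟩ := hk
    have := congrArg (Int.cast : ℤ → ZMod d) hab
    push_cast at this
    rw [ZMod.natCast_self, mul_zero, add_zero] at this
    exact IsUnit.of_mul_eq_one_right _ this
  rw [xi, map_pow, chi, FreeGroup.lift_apply_of, ← ofAdd_nsmul, nsmul_eq_mul, ZMod.natCast_val,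
    ZMod.cast_id', id, ZMod.inv_mul_of_unit _ hu]

/-- The action of the generator `q` of `ℤ/d` on `V_0`: conjugation by any element with image `q`
(see `conjAction_congr` and `chi_xi`). -/
def qAct {n : ℕ} (k : Fin (n + 1) → ℤ) (d : ℕ) : Module.End ℚ (V0 k d) :=
  conjAction k d (xi k d)

theorem qAct_pow {n : ℕ} (k : Fin (n + 1) → ℤ) (d : ℕ) : qAct k d ^ d = 1 := by
  rw [qAct, ← map_pow]
  apply conjAction_of_mem
  rw [MonoidHom.mem_ker, map_pow]
  apply Multiplicative.toAdd.injective
  rw [toAdd_pow, nsmul_eq_mul, ZMod.natCast_self, zero_mul, toAdd_one]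

/-- The submodule `(1 + q + ⋯ + q^{d-1}) V_0`. -/
def normRange {n : ℕ} (k : Fin (n + 1) → ℤ) (d : ℕ) : Submodule ℚ (V0 k d) :=
  LinearMap.range (aeval (qAct k d) (normPoly d))

/-- The quotient `V_0^{ni} = V_0 / (1 + q + ⋯ + q^{d-1}) V_0`. -/
def V0ni {n : ℕ} (k : Fin (n + 1) → ℤ) (d : ℕ) : Type := V0 k d ⧸ normRange k d

instance {n : ℕ} (k : Fin (n + 1) → ℤ) (d : ℕ) : AddCommGroup (V0ni k d) :=
  inferInstanceAs (AddCommGroup (V0 k d ⧸ normRange k d))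

instance {n : ℕ} (k : Fin (n + 1) → ℤ) (d : ℕ) : Module ℚ (V0ni k d) :=
  inferInstanceAs (Module ℚ (V0 k d ⧸ normRange k d))

/-- The projection `V_0 → V_0^{ni}`. -/
def V0ni.mk {n : ℕ} (k : Fin (n + 1) → ℤ) (d : ℕ) : V0 k d →ₗ[ℚ] V0ni k d :=
  (normRange k d).mkQ

theorem V0ni.mk_surjective {n : ℕ} (k : Fin (n + 1) → ℤ) (d : ℕ) :
    Function.Surjective (V0ni.mk k d) := (normRange k d).mkQ_surjective

/-- An endomorphism of `V_0` that commutes with `q` acts on `V_0^{ni}`. -/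
def V0ni.map {n : ℕ} (k : Fin (n + 1) → ℤ) (d : ℕ) (f : Module.End ℚ (V0 k d))
    (hf : Commute f (qAct k d)) : Module.End ℚ (V0ni k d) :=
  (normRange k d).mapQ (normRange k d) f (by
    rintro _ ⟨v, rfl⟩
    have hc : Commute f (aeval (qAct k d) (normPoly d)) := by
      rw [normPoly, map_sum]
      refine Commute.sum_right _ _ _ fun i _ => ?_
      rw [map_pow, aeval_X]
      exact hf.pow_right i
    exact ⟨f v, (DFunLike.congr_fun hc.eq v).symm⟩)

theorem V0ni.map_mk {n : ℕ} (k : Fin (n + 1) → ℤ) (d : ℕ) (f : Module.End ℚ (V0 k d))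
    (hf : Commute f (qAct k d)) (v : V0 k d) :
    V0ni.map k d f hf (V0ni.mk k d v) = V0ni.mk k d (f v) := rfl

/-- The action of `q` on `V_0^{ni}`. -/
def qActNi {n : ℕ} (k : Fin (n + 1) → ℤ) (d : ℕ) : Module.End ℚ (V0ni k d) :=
  V0ni.map k d (qAct k d) (Commute.refl _)

theorem aeval_qActNi_mk {n : ℕ} (k : Fin (n + 1) → ℤ) (d : ℕ) (f : ℚ[X]) (v : V0 k d) :
    aeval (qActNi k d) f (V0ni.mk k d v) = V0ni.mk k d (aeval (qAct k d) f v) := by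
  induction f using Polynomial.induction_on' generalizing v with
  | add f g hf hg => simp [hf, hg]
  | monomial m a =>
    have h : ∀ v, (qActNi k d ^ m) (V0ni.mk k d v) = V0ni.mk k d ((qAct k d ^ m) v) := by
      induction m with
      | zero => intro v; simp
      | succ m ih =>
        intro v
        rw [pow_succ, pow_succ, Module.End.mul_apply, Module.End.mul_apply, qActNi, V0ni.map_mk,
          ← qActNi, ih]
    simp [aeval_monomial, h]

theorem aeval_normPoly {n : ℕ} (k : Fin (n + 1) → ℤ) (d : ℕ) :
    aeval (qActNi k d) (normPoly d) = 0 := by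
  ext1 v
  obtain ⟨v, rfl⟩ := V0ni.mk_surjective k d v
  rw [aeval_qActNi_mk]
  exact (Submodule.Quotient.mk_eq_zero _).mpr ⟨v, rfl⟩

/-- The homomorphism `R_d → End (V_0^{ni})`, with `q` acting through `ℤ/d`. -/
def ringRdAct {n : ℕ} (k : Fin (n + 1) → ℤ) (d : ℕ) :
    RingRd d →ₐ[ℚ] Module.End ℚ (V0ni k d) :=
  Ideal.Quotient.liftₐ _ (aeval (qActNi k d)) (by
    intro a ha
    obtain ⟨b, rfl⟩ := Ideal.mem_span_singleton.mp ha
    rw [map_mul, aeval_normPoly, zero_mul])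

/-- The `R_d`-module structure of `V_0^{ni}`. -/
instance {n : ℕ} (k : Fin (n + 1) → ℤ) (d : ℕ) : Module (RingRd d) (V0ni k d) :=
  Module.compHom (V0ni k d) (ringRdAct k d).toRingHom

theorem ringRd_smul_def {n : ℕ} (k : Fin (n + 1) → ℤ) (d : ℕ) (r : RingRd d) (v : V0ni k d) :
    r • v = ringRdAct k d r v := rfl

theorem qElt_smul {n : ℕ} (k : Fin (n + 1) → ℤ) (d : ℕ) (v : V0ni k d) :
    qElt d • v = qActNi k d v := by
  change aeval (qActNi k d) X v = _
  rw [aeval_X]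

instance {n : ℕ} (k : Fin (n + 1) → ℤ) (d : ℕ) : IsScalarTower ℚ (RingRd d) (V0ni k d) where
  smul_assoc a r v := by
    rw [ringRd_smul_def, ringRd_smul_def, map_smul, LinearMap.smul_apply]

/-- The action of the pure braid group on `K_0(k, d)`. -/
def pureActionK0 {n : ℕ} (k : Fin (n + 1) → ℤ) (d : ℕ) :
    pureBraidGroup n →* Monoid.End (K0 k d) where
  toFun p := ((pureAction n p).toMonoidHom.comp (K0 k d).subtype).codRestrict (K0 k d) (by
    intro x
    change chi k d (pureAction n p x) = 1
    rw [pureAction_trivial]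
    exact x.2)
  map_one' := by
    refine MonoidHom.ext fun x => Subtype.ext ?_
    change pureAction n 1 x = x
    rw [map_one, MulAut.one_apply]
  map_mul' p q := by
    refine MonoidHom.ext fun x => Subtype.ext ?_
    change pureAction n (p * q) x = pureAction n p (pureAction n q x)
    rw [map_mul, MulAut.mul_apply]

theorem pureActionK0_coe {n : ℕ} (k : Fin (n + 1) → ℤ) (d : ℕ) (p : pureBraidGroup n)
    (x : K0 k d) : (pureActionK0 k d p x : FreeGroup (Fin (n + 1))) = pureAction n p x := rfl

/-- The action of the pure braid group on `V_0`. -/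
def pureActionV0 {n : ℕ} (k : Fin (n + 1) → ℤ) (d : ℕ) :
    Representation ℚ (pureBraidGroup n) (V0 k d) :=
  (H1Qmap (K0 k d)).comp (pureActionK0 k d)

theorem pureActionV0_conj {n : ℕ} (k : Fin (n + 1) → ℤ) (d : ℕ) (p : pureBraidGroup n)
    (x : FreeGroup (Fin (n + 1))) :
    Commute (pureActionV0 k d p) (conjAction k d x) := by
  have h1 : pureActionV0 k d p * conjAction k d x =
      conjAction k d (pureAction n p x) * pureActionV0 k d p := by
    simp only [pureActionV0, conjAction, MonoidHom.comp_apply]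
    rw [← map_mul, ← map_mul]
    congr 1
    refine MonoidHom.ext fun y => Subtype.ext ?_
    change pureAction n p (x * y * x⁻¹) =
      pureAction n p x * pureAction n p y * (pureAction n p x)⁻¹
    rw [map_mul, map_mul, map_inv]
  rw [Commute, SemiconjBy, h1, conjAction_congr k d (pureAction_trivial (chi k d) p x)]

theorem pureActionV0_comm {n : ℕ} (k : Fin (n + 1) → ℤ) (d : ℕ) (p : pureBraidGroup n) :
    Commute (pureActionV0 k d p) (qAct k d) := pureActionV0_conj k d p _

/-- The representation of the pure braid group on `V_0^{ni}`, over `ℚ`. -/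
def homologyRepQ {n : ℕ} (k : Fin (n + 1) → ℤ) (d : ℕ) :
    Representation ℚ (pureBraidGroup n) (V0ni k d) where
  toFun p := V0ni.map k d (pureActionV0 k d p) (pureActionV0_comm k d p)
  map_one' := by
    refine LinearMap.ext fun v => ?_
    obtain ⟨v, rfl⟩ := V0ni.mk_surjective k d v
    rw [V0ni.map_mk, map_one, Module.End.one_apply, Module.End.one_apply]
  map_mul' p q := by
    refine LinearMap.ext fun v => ?_
    obtain ⟨v, rfl⟩ := V0ni.mk_surjective k d v
    rw [Module.End.mul_apply, V0ni.map_mk, V0ni.map_mk, V0ni.map_mk, map_mul, Module.End.mul_apply]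

theorem homologyRepQ_mk {n : ℕ} (k : Fin (n + 1) → ℤ) (d : ℕ) (p : pureBraidGroup n)
    (v : V0 k d) :
    homologyRepQ k d p (V0ni.mk k d v) = V0ni.mk k d (pureActionV0 k d p v) := rfl

theorem homologyRepQ_smul {n : ℕ} (k : Fin (n + 1) → ℤ) (d : ℕ) (p : pureBraidGroup n)
    (r : RingRd d) (v : V0ni k d) : homologyRepQ k d p (r • v) = r • homologyRepQ k d p v := by
  obtain ⟨f, rfl⟩ := Ideal.Quotient.mk_surjective r
  obtain ⟨v, rfl⟩ := V0ni.mk_surjective k d v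
  have hc : Commute (pureActionV0 k d p) (aeval (qAct k d) f) := by
    induction f using Polynomial.induction_on' with
    | add f g hf hg => rw [map_add]; exact hf.add_right hg
    | monomial m a =>
      rw [aeval_monomial]
      exact (Algebra.commute_algebraMap_right a _).mul_right
        ((pureActionV0_comm k d p).pow_right m)
  have hs : ∀ u : V0 k d, (Ideal.Quotient.mk (Ideal.span {normPoly d}) f) • V0ni.mk k d u =
      V0ni.mk k d (aeval (qAct k d) f u) := fun u => aeval_qActNi_mk k d f u
  rw [hs, homologyRepQ_mk, homologyRepQ_mk, hs]
  exact congrArg (V0ni.mk k d) (DFunLike.congr_fun hc.eq v)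

/-- The representation of the pure braid group on `V_0^{ni}`, over `R_d`. -/
def homologyRep {n : ℕ} (k : Fin (n + 1) → ℤ) (d : ℕ) :
    Representation (RingRd d) (pureBraidGroup n) (V0ni k d) where
  toFun p :=
    { toFun := homologyRepQ k d p
      map_add' := map_add (homologyRepQ k d p)
      map_smul' := homologyRepQ_smul k d p }
  map_one' := LinearMap.ext fun v => DFunLike.congr_fun (map_one (homologyRepQ k d)) v
  map_mul' p q := LinearMap.ext fun v => DFunLike.congr_fun (map_mul (homologyRepQ k d) p q) v

/-- The divisors `e ≥ 2` of `d`. -/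
abbrev NontrivDivisor (d : ℕ) : Type := {e : ℕ // e ∣ d ∧ 2 ≤ e}

instance {d : ℕ} (e : NontrivDivisor d) : NeZero (e : ℕ) := ⟨by have := e.2.2; omega⟩

end PureBraid

end

/-!
A crossed homomorphism on `F_{n+1}` is additive on any subgroup on which its character is trivial.
The Magnus crossed homomorphism into `W`, specialised at `X_i ↦ q^{k_i}`, therefore induces an
`R_d`-linear, `P_{n+1}`-equivariant map `V_0^{ni} → R_d^n`.

To see that it is bijective, let `ξ` be a power of `x_1` with image `q`. The class of `[x, ξ]` in
`V_0^{ni}` is a crossed homomorphism of `x` which vanishes at `x_1` and which, for `x` in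
`K_0(k, d)`, is `1 - q` times the class of `x`. As `1 - q` is a unit of `R_d`, the `n` classes
`[x_2, ξ], …, [x_{n+1}, ξ]` generate `V_0^{ni}`. They are mapped to the vectors
`(1 - q) (1 - q^{k_i}) (v_i - v_1)`, which generate `R_d^n` because `1 - q^{k_i}` is a unit too.
A surjection onto `R_d^n` from a module with `n` generators is bijective. The decomposition over `ℚ`
follows from `R_d ≅ ∏ E_e`, the Chinese remainder theorem for the cyclotomic polynomials.
-/

noncomputable section

open scoped commutatorElement

namespace PureBraid

/-! ### Crossed homomorphisms -/

/-- A crossed homomorphism `f : G → M`, where `G` acts on `M` through the character `χ`. -/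
def IsCrossedHom {G A M : Type*} [Group G] [Ring A] [AddCommGroup M] [Module A M]
    (χ : G →* A) (f : G → M) : Prop :=
  ∀ x y, f (x * y) = f x + χ x • f y

namespace IsCrossedHom

section Ring

variable {G A M : Type*} [Group G] [Ring A] [AddCommGroup M] [Module A M] {χ : G →* A} {f : G → M}

protected theorem map_one (hf : IsCrossedHom χ f) : f 1 = 0 := by
  simpa using hf 1 1

theorem smul_map_inv (hf : IsCrossedHom χ f) (x : G) : χ x • f x⁻¹ = -f x := by
  rw [eq_neg_iff_add_eq_zero, add_comm, ← hf, mul_inv_cancel, hf.map_one]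

theorem map_inv_eq_smul (hf : IsCrossedHom χ f) (x : G) : f x⁻¹ = -(χ x⁻¹ • f x) := by
  rw [eq_neg_iff_add_eq_zero, ← hf, inv_mul_cancel, hf.map_one]

theorem map_mem_of_mem_closure (hf : IsCrossedHom χ f) {S : Set G} {N : Submodule A M}
    (hS : ∀ s ∈ S, f s ∈ N) {x : G} (hx : x ∈ Subgroup.closure S) : f x ∈ N := by
  induction hx using Subgroup.closure_induction with
  | mem s hs => exact hS s hs
  | one => rw [hf.map_one]; exact N.zero_mem
  | mul x y _ _ hx hy => rw [hf]; exact N.add_mem hx (N.smul_mem _ hy)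
  | inv x _ hx => rw [hf.map_inv_eq_smul]; exact N.neg_mem (N.smul_mem _ hx)

/-- A crossed homomorphism is additive on a subgroup on which its character is trivial. -/
def restrict (hf : IsCrossedHom χ f) (K : Subgroup G) (hK : ∀ x ∈ K, χ x = 1) :
    Additive K →+ M :=
  AddMonoidHom.mk' (fun x => f x.toMul) fun x y => by
    rw [toMul_add, Subgroup.coe_mul, hf, hK _ x.toMul.2, one_smul]

theorem restrict_apply (hf : IsCrossedHom χ f) (K : Subgroup G) (hK : ∀ x ∈ K, χ x = 1)
    (x : Additive K) : hf.restrict K hK x = f x.toMul := rfl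

end Ring

section CommRing

variable {G A M : Type*} [Group G] [CommRing A] [AddCommGroup M] [Module A M]
  {χ : G →* A} {f : G → M}

theorem map_conj (hf : IsCrossedHom χ f) (w x : G) :
    f (w * x * w⁻¹) = (1 - χ x) • f w + χ w • f x := by
  rw [hf, hf, map_mul, mul_comm (χ w), mul_smul, hf.smul_map_inv]
  module

theorem map_conj_of_eq_one (hf : IsCrossedHom χ f) (w : G) {x : G} (hx : χ x = 1) :
    f (w * x * w⁻¹) = χ w • f x := by
  rw [hf.map_conj, hx, sub_self, zero_smul, zero_add]

theorem map_commutator (hf : IsCrossedHom χ f) (x y : G) :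
    f ⁅x, y⁆ = (1 - χ y) • f x - (1 - χ x) • f y := by
  have hχ : χ (x * y * x⁻¹) = χ y := by
    rw [map_mul, map_mul, mul_right_comm, ← map_mul, mul_inv_cancel, map_one, one_mul]
  rw [commutatorElement_def, hf, hχ, hf.smul_map_inv, hf.map_conj]
  module

end CommRing

end IsCrossedHom

/-! ### Units, linear maps and polynomials -/

theorem one_sub_dvd_one_sub_zpow {A : Type*} [CommRing A] (u : Aˣ) (m : ℤ) :
    (1 - u : A) ∣ 1 - (u ^ m : Aˣ) := by
  have hnat (i : ℕ) : (1 - u : A) ∣ 1 - (u ^ i : Aˣ) := by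
    rw [Units.val_pow_eq_pow_val]
    exact one_sub_dvd_one_sub_pow _ i
  obtain ⟨i, rfl | rfl⟩ := m.eq_nat_or_neg
  · exact_mod_cast hnat i
  · have hneg : (1 - (u ^ (-(i : ℤ)) : Aˣ) : A) = -(u ^ (-(i : ℤ)) : Aˣ) * (1 - (u ^ i : Aˣ)) := by
      rw [mul_sub, mul_one, neg_mul, ← Units.val_mul, zpow_neg, zpow_natCast, inv_mul_cancel,
        Units.val_one]
      ring
    rw [hneg]
    exact (hnat i).mul_left _

theorem isUnit_one_sub_zpow {A : Type*} [CommRing A] {u : Aˣ} {d : ℕ} (hud : u ^ d = 1)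
    (hu : IsUnit (1 - u : A)) {m : ℤ} (hm : IsCoprime m d) : IsUnit (1 - (u ^ m : Aˣ) : A) := by
  obtain ⟨a, b, hab⟩ := hm
  have hroot : (u ^ m) ^ a = u := by
    calc (u ^ m) ^ a = (u ^ m) ^ a * (u ^ d) ^ b := by rw [hud, one_zpow, mul_one]
      _ = u ^ (a * m + b * d) := by
        rw [zpow_add, mul_comm a, zpow_mul, mul_comm b, zpow_mul, zpow_natCast]
      _ = u := by rw [hab, zpow_one]
  refine isUnit_of_dvd_unit ?_ hu
  conv_rhs => rw [← hroot]
  exact one_sub_dvd_one_sub_zpow (u ^ m) a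

theorem isUnit_one_sub_of_geom_sum_eq_zero {A : Type*} [CommRing A] {q : A} {d : ℕ}
    (hd : IsUnit (d : A)) (hq : ∑ i ∈ Finset.range d, q ^ i = 0) : IsUnit (1 - q) := by
  have hsum : (d : A) = ∑ i ∈ Finset.range d, (1 - q ^ i) := by simp [hq]
  refine isUnit_of_dvd_unit ?_ hd
  rw [hsum]
  exact Finset.dvd_sum fun i _ => one_sub_dvd_one_sub_pow q i

theorem bijective_of_surjective_of_span_eq_top {R M ι : Type*} [CommRing R] [AddCommGroup M]
    [Module R M] [Finite ι] {f : M →ₗ[R] ι → R} (hf : Function.Surjective f) {v : ι → M}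
    (hv : Submodule.span R (Set.range v) = ⊤) : Function.Bijective f := by
  have := Fintype.ofFinite ι
  have hsurj : Function.Surjective (Fintype.linearCombination R v) := by
    rw [← LinearMap.range_eq_top, Fintype.range_linearCombination, hv]
  have hinj : Function.Injective (f ∘ₗ Fintype.linearCombination R v) :=
    OrzechProperty.injective_of_surjective_endomorphism _ (hf.comp hsurj)
  exact ⟨Function.Injective.of_comp_right hinj hsurj, hf⟩

theorem map_aeval_of_semiconj {R V W : Type*} [CommRing R] [AddCommGroup V] [Module R V]
    [AddCommGroup W] [Module R W] {g : V →ₗ[R] W} {S : Module.End R V} {T : Module.End R W}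
    (h : ∀ v, g (S v) = T (g v)) (p : R[X]) (v : V) : g (aeval S p v) = aeval T p (g v) := by
  have hpow (m : ℕ) : g ((S ^ m) v) = (T ^ m) (g v) := by
    simp only [Module.End.pow_apply]
    exact Function.Semiconj.iterate_right h m v
  induction p using Polynomial.induction_on' with
  | add p₁ p₂ h₁ h₂ => simp only [map_add, LinearMap.add_apply, h₁, h₂]
  | monomial m a => simp [aeval_monomial, Module.algebraMap_end_apply, hpow]

section Pi

variable {K ι : Type*} [Field K] {E : ι → Type*} [∀ i, CommRing (E i)]
  [∀ i, Algebra K (E i)] {z : ∀ i, E i}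

theorem aeval_pi_surjective [Finite ι]
    (hz : Pairwise fun i j => IsCoprime (minpoly K (z i)) (minpoly K (z j)))
    (hgen : ∀ i, Algebra.adjoin K {z i} = ⊤) :
    Function.Surjective (aeval z : K[X] →ₐ[K] ∀ i, E i) := by
  intro w
  have hw (i : ι) : ∃ f : K[X], aeval (z i) f = w i := by
    have hmem : w i ∈ Algebra.adjoin K {z i} := hgen i ▸ Algebra.mem_top
    rwa [Algebra.adjoin_singleton_eq_range_aeval] at hmem
  choose f hf using hw
  obtain ⟨g, hg⟩ := Ideal.exists_forall_sub_mem_ideal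
    (fun i j hij => (Ideal.isCoprime_span_singleton_iff _ _).mpr (hz hij)) f
  refine ⟨g, funext fun i => ?_⟩
  have hgi := (minpoly.dvd_iff).mp (Ideal.mem_span_singleton.mp (hg i))
  rw [aeval_pi_apply₂, ← hf i, ← sub_eq_zero, ← map_sub, hgi]

theorem ker_aeval_pi [Fintype ι]
    (hz : Pairwise fun i j => IsCoprime (minpoly K (z i)) (minpoly K (z j))) :
    RingHom.ker (aeval z : K[X] →ₐ[K] ∀ i, E i) = Ideal.span {∏ i, minpoly K (z i)} := by
  ext f
  rw [RingHom.mem_ker, Ideal.mem_span_singleton]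
  have hf : aeval z f = 0 ↔ ∀ i, minpoly K (z i) ∣ f := by
    simp only [funext_iff, aeval_pi_apply₂, Pi.zero_apply, minpoly.dvd_iff]
  rw [hf]
  exact ⟨fun h => Finset.prod_dvd_of_coprime (fun i _ j _ hij => hz hij) fun i _ => h i,
    fun h i => (Finset.dvd_prod_of_mem _ (Finset.mem_univ i)).trans h⟩

end Pi

/-- The homomorphism `ℤ/d → G`, `1 ↦ u`, for an element `u` with `u ^ d = 1`. -/
def zmodPowersHom {G : Type*} [Group G] {u : G} {d : ℕ} (hu : u ^ d = 1) :
    Multiplicative (ZMod d) →* G :=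
  AddMonoidHom.toMultiplicativeLeft (ZMod.lift d ⟨zmultiplesHom (Additive G) (Additive.ofMul u), by
    rw [zmultiplesHom_apply, natCast_zsmul, ← ofMul_pow, hu, ofMul_one]⟩)

theorem zmodPowersHom_ofAdd_intCast {G : Type*} [Group G] {u : G} {d : ℕ} (hu : u ^ d = 1)
    (m : ℤ) : zmodPowersHom hu (Multiplicative.ofAdd (m : ZMod d)) = u ^ m := by
  simp [zmodPowersHom]

/-! ### The ring `R_d` and its decomposition into cyclotomic fields -/

theorem qUnit_val (d : ℕ) [NeZero d] : (qUnit d : RingRd d) = qElt d := rfl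

theorem qUnit_pow (d : ℕ) [NeZero d] : qUnit d ^ d = 1 :=
  Units.ext (by rw [Units.val_pow_eq_pow_val, qUnit_val, qElt_pow, Units.val_one])

theorem isUnit_one_sub_qElt (d : ℕ) [NeZero d] : IsUnit (1 - qElt d) := by
  have hd : IsUnit (d : RingRd d) := by
    have hmap := (IsUnit.mk0 (d : ℚ) (NeZero.ne _)).map (algebraMap ℚ (RingRd d))
    rwa [map_natCast] at hmap
  refine isUnit_one_sub_of_geom_sum_eq_zero hd ?_
  simp only [qElt, ← map_pow, ← map_sum]
  exact Ideal.Quotient.eq_zero_iff_mem.mpr (Ideal.mem_span_singleton_self _)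

theorem mem_divisors_erase_one_iff {d e : ℕ} [NeZero d] :
    e ∈ d.divisors.erase 1 ↔ e ∣ d ∧ 2 ≤ e := by
  rw [Finset.mem_erase, Nat.mem_divisors]
  constructor
  · rintro ⟨hne, hdvd, -⟩
    have := Nat.pos_of_dvd_of_pos hdvd (NeZero.pos d)
    exact ⟨hdvd, by omega⟩
  · rintro ⟨hdvd, hle⟩
    exact ⟨by omega, hdvd, NeZero.ne d⟩

instance (d : ℕ) [NeZero d] : Fintype (NontrivDivisor d) :=
  Fintype.subtype (d.divisors.erase 1) fun _ => mem_divisors_erase_one_iff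

theorem minpoly_omegaUnit (e : ℕ) [NeZero e] :
    minpoly ℚ (omegaUnit e : CyclotomicField e ℚ) = cyclotomic e ℚ :=
  (cyclotomic_eq_minpoly_rat (IsCyclotomicExtension.zeta_spec e ℚ _) (NeZero.pos e)).symm

theorem adjoin_omegaUnit (e : ℕ) [NeZero e] :
    Algebra.adjoin ℚ {(omegaUnit e : CyclotomicField e ℚ)} = ⊤ :=
  IsCyclotomicExtension.adjoin_primitive_root_eq_top (IsCyclotomicExtension.zeta_spec e ℚ _)

theorem normPoly_eq_prod_minpoly (d : ℕ) [NeZero d] :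
    normPoly d =
      ∏ e : NontrivDivisor d, minpoly ℚ (omegaUnit (e : ℕ) : CyclotomicField (e : ℕ) ℚ) := by
  simp only [minpoly_omegaUnit]
  rw [normPoly, ← prod_cyclotomic_eq_geom_sum (NeZero.pos d)]
  exact Finset.prod_subtype _ (fun _ => mem_divisors_erase_one_iff) _

theorem pairwise_isCoprime_minpoly_omegaUnit (d : ℕ) :
    Pairwise fun e e' : NontrivDivisor d =>
      IsCoprime (minpoly ℚ (omegaUnit (e : ℕ) : CyclotomicField (e : ℕ) ℚ))
        (minpoly ℚ (omegaUnit (e' : ℕ) : CyclotomicField (e' : ℕ) ℚ)) := by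
  intro e e' hee'
  rw [minpoly_omegaUnit, minpoly_omegaUnit]
  exact cyclotomic.isCoprime_rat (Subtype.coe_ne_coe.mpr hee')

/-- The isomorphism `R_d ≅ ∏ E_e`, `q ↦ (ω_e)_e`, over the divisors `e ≥ 2` of `d`. -/
def cyclotomicEquiv (d : ℕ) [NeZero d] :
    RingRd d ≃ₐ[ℚ] ∀ e : NontrivDivisor d, CyclotomicField (e : ℕ) ℚ :=
  (Ideal.quotientEquivAlgOfEq ℚ (by
    rw [normPoly_eq_prod_minpoly, ker_aeval_pi (pairwise_isCoprime_minpoly_omegaUnit d)])).trans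
    (Ideal.quotientKerAlgEquivOfSurjective
      (aeval_pi_surjective (pairwise_isCoprime_minpoly_omegaUnit d) fun e => adjoin_omegaUnit e))

/-- The homomorphism `R_d → E_e`, `q ↦ ω_e`, for a divisor `e ≥ 2` of `d`. -/
def toCyclotomic {d : ℕ} [NeZero d] (e : NontrivDivisor d) :
    RingRd d →ₐ[ℚ] CyclotomicField (e : ℕ) ℚ :=
  (Pi.evalAlgHom ℚ _ e).comp (cyclotomicEquiv d).toAlgHom

theorem toCyclotomic_qElt {d : ℕ} [NeZero d] (e : NontrivDivisor d) :
    toCyclotomic e (qElt d) = omegaUnit (e : ℕ) := by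
  change aeval (fun e : NontrivDivisor d => (omegaUnit (e : ℕ) : CyclotomicField (e : ℕ) ℚ)) X e = _
  rw [aeval_X]

theorem nontrivial_ringRd {d : ℕ} [NeZero d] (hd : 2 ≤ d) : Nontrivial (RingRd d) :=
  (toCyclotomic (⟨d, dvd_rfl, hd⟩ : NontrivDivisor d)).toRingHom.domain_nontrivial

/-! ### Specialisations of the reduced Gassner representation -/

section Specialisation

variable {n : ℕ} {A B : Type} [CommRing A] [CommRing B] (t : Fin (n + 1) → Aˣ)

theorem specialise_of (m : Lattice n) :
    specialise t (MonoidAlgebra.of ℤ _ m) = ((∏ i, t i ^ m.toAdd i : Aˣ) : A) :=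
  MonoidAlgebra.lift_of _ _

theorem specialise_varX (i : Fin (n + 1)) : specialise t (varX i) = t i := by
  rw [varX, specialise_of, Finset.prod_eq_single i]
  · simp [latticeGen]
  · intro j _ hj
    simp [latticeGen, hj]
  · simp

theorem comp_specialise (f : A →+* B) :
    f.comp (specialise t) = specialise fun i => Units.map f.toMonoidHom (t i) := by
  refine MonoidAlgebra.ringHom_ext' (RingHom.ext_int _ _) (MonoidHom.ext fun m => ?_)
  change f (specialise t (MonoidAlgebra.of ℤ _ m)) = specialise _ (MonoidAlgebra.of ℤ _ m)
  rw [specialise_of, specialise_of]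
  simp only [← map_zpow, ← map_prod]
  rfl

theorem reducedGassnerAt_apply (p : pureBraidGroup n) (w : Fin n → A) :
    reducedGassnerAt t p w = ((reducedGassnerMatrix n p).map (specialise t)).mulVec w := rfl

theorem comp_reducedGassnerAt (f : A →+* B) (p : pureBraidGroup n) (w : Fin n → A) :
    f ∘ reducedGassnerAt t p w =
      reducedGassnerAt (fun i => Units.map f.toMonoidHom (t i)) p (f ∘ w) := by
  ext j
  rw [reducedGassnerAt_apply, reducedGassnerAt_apply, Function.comp_apply, RingHom.map_mulVec,
    Matrix.map_map, ← comp_specialise]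
  rfl

/-- The character `x_i ↦ t_i` of the free group, read off from the monomial part. -/
def charAt : FreeGroup (Fin (n + 1)) →* A where
  toFun x := specialise t (monoPart x)
  map_one' := by rw [monoPart_one, map_one]
  map_mul' x y := by rw [monoPart_mul, map_mul]

theorem charAt_of (i : Fin (n + 1)) : charAt t (FreeGroup.of i) = t i := by
  change specialise t (monoPart (FreeGroup.of i)) = t i
  rw [monoPart_of, specialise_varX]

/-- The coordinates in the basis `ε_1, …, ε_n` of `W`, specialised at `X_i ↦ t_i`. -/
def coordAt : reducedModule n →ₛₗ[specialise t] (Fin n → A) where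
  toFun w i := specialise t ((epsBasis n).repr w i)
  map_add' w w' := by ext i; simp
  map_smul' r w := by ext i; simp

theorem coordAt_epsBasis (i : Fin n) : coordAt t (epsBasis n i) = Pi.single i 1 := by
  ext j
  change specialise t ((epsBasis n).repr (epsBasis n i) j) = _
  rw [Module.Basis.repr_self, Finsupp.single_apply, Pi.single_apply]
  simp only [eq_comm, apply_ite (specialise t), map_one, map_zero]

theorem coordAt_reducedGassner (p : pureBraidGroup n) (w : reducedModule n) :
    coordAt t (reducedGassner n p w) = reducedGassnerAt t p (coordAt t w) := by
  ext j
  have h : (reducedGassnerMatrix n p).mulVec ((epsBasis n).repr w) =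
      (epsBasis n).repr (reducedGassner n p w) :=
    LinearMap.toMatrix_mulVec_repr (epsBasis n) (epsBasis n) (reducedGassner n p) w
  change specialise t ((epsBasis n).repr (reducedGassner n p w) j) = _
  rw [reducedGassnerAt_apply, ← h, RingHom.map_mulVec]
  rfl

end Specialisation

/-! ### The crossed homomorphism `F_{n+1} → W` -/

section Crossed

variable {n : ℕ}

/-- The crossed homomorphism `F_{n+1} → W` obtained from `vecPart` by subtracting the principal
crossed homomorphism of `v_1`. -/
def reducedVec (x : FreeGroup (Fin (n + 1))) : reducedModule n :=
  ⟨toOmega (vecPart x) - (1 - monoPart x) • vVec 0, vecPart_mem x⟩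

theorem reducedVec_mul (x y : FreeGroup (Fin (n + 1))) :
    reducedVec (x * y) = reducedVec x + monoPart x • reducedVec y := by
  apply Subtype.ext
  simp only [reducedVec, Submodule.coe_add, Submodule.coe_smul]
  rw [vecPart_mul, monoPart_mul, map_add, map_smul]
  module

/-- The vector `v_i - v_1` of `W`. -/
def vSub (i : Fin (n + 1)) : reducedModule n := ⟨vVec i - vVec 0, vVec_sub_mem i⟩

theorem vSub_zero : vSub (0 : Fin (n + 1)) = 0 :=
  Subtype.ext (sub_self _)

theorem epsBasis_eq (i : Fin n) : epsBasis n i = vSub i.castSucc - vSub i.succ := by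
  apply Subtype.ext
  have hval : (epsBasis n i : Fin (n + 1) → Omega n) = epsVec i :=
    congrArg Subtype.val (Module.Basis.span_apply (epsVec_linearIndependent n) i)
  simp [hval, vSub, epsVec]

theorem reducedVec_of (i : Fin (n + 1)) :
    reducedVec (FreeGroup.of i) = (1 - varX i) • vSub i := by
  apply Subtype.ext
  simp only [reducedVec, vSub, Submodule.coe_smul]
  rw [vecPart_of, monoPart_of, ← one_sub_smul_vVec, smul_sub]

theorem exists_reducedGassner_reducedVec (p : pureBraidGroup n) : ∃ u : reducedModule n,
    ∀ x, reducedGassner n p (reducedVec x) =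
      reducedVec (pureAction n p x) - (1 - monoPart x) • u := by
  obtain ⟨w, hw⟩ := gassnerOmega_vVec p 0
  refine ⟨reducedVec w, fun x => Subtype.ext ?_⟩
  change gassnerOmega n p (toOmega (vecPart x) - (1 - monoPart x) • vVec 0) =
    toOmega (vecPart (pureAction n p x)) - (1 - monoPart (pureAction n p x)) • vVec 0 -
      (1 - monoPart x) • (toOmega (vecPart w) - (1 - monoPart w) • vVec 0)
  rw [map_sub, map_smul, gassnerOmega_toOmega, gassnerMatrix_mulVec, monoPart_pure, hw]
  module

variable {A : Type} [CommRing A] (t : Fin (n + 1) → Aˣ)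

/-- The specialisation `F_{n+1} → A^n` of the crossed homomorphism `reducedVec`. -/
def crossedAt (x : FreeGroup (Fin (n + 1))) : Fin n → A := coordAt t (reducedVec x)

theorem isCrossedHom_crossedAt : IsCrossedHom (charAt t) (crossedAt t) := fun x y => by
  rw [crossedAt, reducedVec_mul, map_add, map_smulₛₗ]
  rfl

theorem crossedAt_of (i : Fin (n + 1)) :
    crossedAt t (FreeGroup.of i) = (1 - t i : A) • coordAt t (vSub i) := by
  rw [crossedAt, reducedVec_of, map_smulₛₗ, map_sub, map_one, specialise_varX]

theorem crossedAt_of_zero : crossedAt t (FreeGroup.of 0) = 0 := by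
  rw [crossedAt_of, vSub_zero, map_zero, smul_zero]

theorem crossedAt_pureAction (p : pureBraidGroup n) {x : FreeGroup (Fin (n + 1))}
    (hx : charAt t x = 1) :
    crossedAt t (pureAction n p x) = reducedGassnerAt t p (crossedAt t x) := by
  obtain ⟨u, hu⟩ := exists_reducedGassner_reducedVec p
  have hx' : specialise t (monoPart x) = 1 := hx
  rw [crossedAt, crossedAt, ← coordAt_reducedGassner, hu, map_sub, map_smulₛₗ, map_sub, map_one,
    hx', sub_self, zero_smul, sub_zero]

theorem eq_top_of_coordAt_vSub_mem {N : Submodule A (Fin n → A)}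
    (hN : ∀ i, coordAt t (vSub i) ∈ N) : N = ⊤ := by
  rw [eq_top_iff, ← (Pi.basisFun A (Fin n)).span_eq, Submodule.span_le]
  rintro _ ⟨i, rfl⟩
  rw [Pi.basisFun_apply, ← coordAt_epsBasis t i, epsBasis_eq, map_sub]
  exact N.sub_mem (hN _) (hN _)

end Crossed

/-! ### Classes in the homology of the cyclic covering -/

namespace H1Q

variable (K : Type) [Group K]

/-- The class in `K^{ab} ⊗ ℚ` of an element of `K`. -/
def of : Additive K →+ H1Q K :=
  (TensorProduct.mk ℤ ℚ (Additive (Abelianization K)) 1).toAddMonoidHom.comp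
    (MonoidHom.toAdditive Abelianization.of)

theorem span_range_of : Submodule.span ℚ (Set.range (of K)) = ⊤ := by
  rw [eq_top_iff]
  rintro v -
  induction v using TensorProduct.induction_on with
  | zero => exact zero_mem _
  | add v w hv hw => exact add_mem hv hw
  | tmul a y =>
    obtain ⟨x, hx⟩ := QuotientGroup.mk_surjective y.toMul
    have hy : y = Additive.ofMul (Abelianization.of x) := congrArg Additive.ofMul hx.symm
    have hay : a ⊗ₜ[ℤ] y = a • of K (Additive.ofMul x) := by
      change _ = a • ((1 : ℚ) ⊗ₜ[ℤ] Additive.ofMul (Abelianization.of x))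
      rw [hy, TensorProduct.smul_tmul', smul_eq_mul, mul_one]
    rw [hay]
    exact Submodule.smul_mem _ a (Submodule.subset_span ⟨_, rfl⟩)

variable {K} {M : Type*} [AddCommGroup M] [Module ℚ M]

/-- The linear map on `K^{ab} ⊗ ℚ` induced by a homomorphism from `K` to a rational vector
space. -/
def lift (c : Additive K →+ M) : H1Q K →ₗ[ℚ] M :=
  (MonoidHom.toAdditiveLeft (Abelianization.lift
    (AddMonoidHom.toMultiplicativeRight c))).toIntLinearMap.liftBaseChange ℚ

theorem lift_of (c : Additive K →+ M) (x : Additive K) : lift c (of K x) = c x := by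
  change ((1 : ℚ) • c x) = c x
  rw [one_smul]

end H1Q

section QChar

variable {n : ℕ} (k : Fin (n + 1) → ℤ) (d : ℕ) [NeZero d]

/-- The point `X_i ↦ q^{k_i}` of specialisation. -/
abbrev qPoint (i : Fin (n + 1)) : (RingRd d)ˣ := qUnit d ^ k i

/-- The character `x_i ↦ q^{k_i}` of the free group, with values in `R_d`. -/
abbrev qChar : FreeGroup (Fin (n + 1)) →* RingRd d := charAt (qPoint k d)

variable {k d}

theorem qChar_apply (x : FreeGroup (Fin (n + 1))) :
    qChar k d x = (zmodPowersHom (qUnit_pow d) (chi k d x) : (RingRd d)ˣ) := by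
  have hfactor : qChar k d =
      (Units.coeHom (RingRd d)).comp ((zmodPowersHom (qUnit_pow d)).comp (chi k d)) := by
    ext i
    change _ = ((zmodPowersHom (qUnit_pow d) (chi k d (FreeGroup.of i)) : (RingRd d)ˣ) : RingRd d)
    rw [charAt_of, chi, FreeGroup.lift_apply_of, zmodPowersHom_ofAdd_intCast]
  exact DFunLike.congr_fun hfactor x

theorem qChar_congr {x y : FreeGroup (Fin (n + 1))} (h : chi k d x = chi k d y) :
    qChar k d x = qChar k d y := by
  rw [qChar_apply, qChar_apply, h]

theorem qChar_eq_one {x : FreeGroup (Fin (n + 1))} (hx : x ∈ K0 k d) : qChar k d x = 1 := by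
  rw [qChar_congr (hx.trans (map_one (chi k d)).symm), map_one]

theorem qChar_xi (hk : IsCoprime (k 0) (d : ℤ)) : qChar k d (xi k d) = qElt d := by
  have hone := zmodPowersHom_ofAdd_intCast (qUnit_pow d) 1
  rw [Int.cast_one, zpow_one] at hone
  rw [qChar_apply, chi_xi k d hk, hone, qUnit_val]

theorem exists_chi_eq_chi_xi_pow (hk : IsCoprime (k 0) (d : ℤ)) (x : FreeGroup (Fin (n + 1))) :
    ∃ m : ℕ, chi k d x = chi k d (xi k d ^ m) := by
  refine ⟨(chi k d x).toAdd.val, ?_⟩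
  rw [map_pow, chi_xi k d hk, ← ofAdd_nsmul, nsmul_eq_mul, mul_one, ZMod.natCast_zmod_val,
    ofAdd_toAdd]

end QChar

namespace V0ni

variable {n : ℕ} (k : Fin (n + 1) → ℤ) (d : ℕ)

theorem mk_smul_mk (f : ℚ[X]) (v : V0 k d) :
    (Ideal.Quotient.mk (Ideal.span {normPoly d}) f) • mk k d v = mk k d (aeval (qAct k d) f v) :=
  aeval_qActNi_mk k d f v

/-- The class in `V_0^{ni}` of an element of `K_0(k, d)`. -/
def of : Additive (K0 k d) →+ V0ni k d :=
  (mk k d).toAddMonoidHom.comp (H1Q.of (K0 k d))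

theorem span_range_of : Submodule.span (RingRd d) (Set.range (of k d)) = ⊤ := by
  have hQ : Submodule.span ℚ (Set.range (of k d)) = ⊤ := by
    have hrange : Set.range (of k d) = mk k d '' Set.range (H1Q.of (K0 k d)) :=
      Set.range_comp (mk k d) (H1Q.of (K0 k d))
    rw [hrange, Submodule.span_image, H1Q.span_range_of, Submodule.map_top,
      LinearMap.range_eq_top.mpr (mk_surjective k d)]
  refine eq_top_iff.mpr fun v _ => Submodule.span_le_restrictScalars ℚ (RingRd d) _ ?_
  rw [hQ]
  trivial

variable {k d}

theorem mk_conjAction [NeZero d] (hk : IsCoprime (k 0) (d : ℤ)) (w : FreeGroup (Fin (n + 1)))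
    (v : V0 k d) : mk k d (conjAction k d w v) = qChar k d w • mk k d v := by
  obtain ⟨m, hm⟩ := exists_chi_eq_chi_xi_pow hk w
  have hX := mk_smul_mk k d (X ^ m) v
  rw [map_pow, map_pow, aeval_X] at hX
  rw [conjAction_congr k d hm, qChar_congr hm, map_pow, map_pow, qChar_xi hk]
  exact hX.symm

theorem of_conj [NeZero d] (hk : IsCoprime (k 0) (d : ℤ)) (w : FreeGroup (Fin (n + 1)))
    (x : K0 k d) : of k d (Additive.ofMul (MulAut.conjNormal w x)) =
      qChar k d w • of k d (Additive.ofMul x) :=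
  mk_conjAction hk w (H1Q.of (K0 k d) (Additive.ofMul x))

theorem homologyRep_of (p : pureBraidGroup n) (x : K0 k d) :
    homologyRep k d p (of k d (Additive.ofMul x)) =
      of k d (Additive.ofMul (pureActionK0 k d p x)) := rfl

section Lift

variable {M : Type*} [AddCommGroup M] [Module ℚ M] [Module (RingRd d) M]
  [IsScalarTower ℚ (RingRd d) M] (c : Additive (K0 k d) →+ M)

theorem lift_aeval_qAct
    (hc : ∀ x, c (Additive.ofMul (MulAut.conjNormal (xi k d) x)) = qElt d • c (Additive.ofMul x))
    (f : ℚ[X]) (v : V0 k d) :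
    H1Q.lift c (aeval (qAct k d) f v) =
      (Ideal.Quotient.mk (Ideal.span {normPoly d}) f) • H1Q.lift c v := by
  have hq : H1Q.lift c ∘ₗ qAct k d = Algebra.lsmul ℚ ℚ M (qElt d) ∘ₗ H1Q.lift c := by
    refine LinearMap.ext_on_range (H1Q.span_range_of (K0 k d)) fun x => ?_
    change H1Q.lift c (H1Q.of (K0 k d) (Additive.ofMul (MulAut.conjNormal (xi k d) x.toMul))) =
      qElt d • H1Q.lift c (H1Q.of (K0 k d) x)
    rw [H1Q.lift_of, H1Q.lift_of, hc, ofMul_toMul]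
  have hf : aeval (qElt d) f = Ideal.Quotient.mk (Ideal.span {normPoly d}) f := by
    change aeval (Ideal.Quotient.mkₐ ℚ (Ideal.span {normPoly d}) X) f = _
    rw [aeval_algHom_apply, aeval_X_left_apply]
    rfl
  rw [map_aeval_of_semiconj (T := Algebra.lsmul ℚ ℚ M (qElt d)) (LinearMap.congr_fun hq),
    aeval_algHom_apply, hf]
  rfl

/-- The `R_d`-linear map on `V_0^{ni}` induced by a homomorphism from `K_0(k, d)` to an
`R_d`-module that turns conjugation by `ξ` into multiplication by `q`. -/
def lift
    (hc : ∀ x, c (Additive.ofMul (MulAut.conjNormal (xi k d) x)) = qElt d • c (Additive.ofMul x)) :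
    V0ni k d →ₗ[RingRd d] M where
  toFun := (normRange k d).liftQ (H1Q.lift c) (by
    rintro _ ⟨v, rfl⟩
    rw [LinearMap.mem_ker, lift_aeval_qAct c hc,
      Ideal.Quotient.eq_zero_iff_mem.mpr (Ideal.mem_span_singleton_self _)]
    exact zero_smul (RingRd d) (H1Q.lift c v))
  map_add' := map_add _
  map_smul' r v := by
    obtain ⟨f, rfl⟩ := Ideal.Quotient.mk_surjective r
    obtain ⟨v, rfl⟩ := mk_surjective k d v
    rw [mk_smul_mk]
    exact lift_aeval_qAct c hc f v

theorem lift_of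
    (hc : ∀ x, c (Additive.ofMul (MulAut.conjNormal (xi k d) x)) = qElt d • c (Additive.ofMul x))
    (x : Additive (K0 k d)) : lift c hc (of k d x) = c x :=
  H1Q.lift_of c x

end Lift

end V0ni

/-! ### Commutator classes -/

section CommutatorClass

variable {n : ℕ} (k : Fin (n + 1) → ℤ) (d : ℕ)

theorem commutator_mem_K0 (x y : FreeGroup (Fin (n + 1))) : ⁅x, y⁆ ∈ K0 k d := by
  rw [MonoidHom.mem_ker, map_commutatorElement, commutatorElement_eq_one_iff_commute]
  exact Commute.all _ _

/-- The class of `[x, ξ]` in `V_0^{ni}`. -/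
def commutatorClass (x : FreeGroup (Fin (n + 1))) : V0ni k d :=
  V0ni.of k d (Additive.ofMul ⟨⁅x, xi k d⁆, commutator_mem_K0 k d x (xi k d)⟩)

theorem commutatorClass_of_zero : commutatorClass k d (FreeGroup.of 0) = 0 := by
  have hcomm : ⁅FreeGroup.of (0 : Fin (n + 1)), xi k d⁆ = 1 :=
    commutatorElement_eq_one_iff_commute.mpr (Commute.self_pow _ _)
  simp only [commutatorClass, hcomm]
  exact map_zero (V0ni.of k d)

variable {k d} [NeZero d]

theorem isCrossedHom_commutatorClass (hk : IsCoprime (k 0) (d : ℤ)) :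
    IsCrossedHom (qChar k d) (commutatorClass k d) := fun x y => by
  have hmul : (⟨⁅x * y, xi k d⁆, commutator_mem_K0 k d _ _⟩ : K0 k d) =
      MulAut.conjNormal x ⟨⁅y, xi k d⁆, commutator_mem_K0 k d _ _⟩ *
        ⟨⁅x, xi k d⁆, commutator_mem_K0 k d _ _⟩ :=
    Subtype.ext (commutatorElement_mul_left_eq_conj_mul x y (xi k d))
  rw [commutatorClass, hmul, ofMul_mul, map_add, V0ni.of_conj hk, add_comm]
  rfl

theorem commutatorClass_coe (hk : IsCoprime (k 0) (d : ℤ)) (x : K0 k d) :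
    commutatorClass k d x = (1 - qElt d) • V0ni.of k d (Additive.ofMul x) := by
  have hdiv : (⟨⁅(x : FreeGroup (Fin (n + 1))), xi k d⁆, commutator_mem_K0 k d _ _⟩ : K0 k d) =
      x / MulAut.conjNormal (xi k d) x := by
    apply Subtype.ext
    rw [Subgroup.coe_div, MulAut.conjNormal_apply, div_eq_mul_inv, conj_inv, ← mul_assoc,
      ← mul_assoc]
    rfl
  rw [commutatorClass, hdiv, ofMul_div, map_sub, V0ni.of_conj hk, qChar_xi hk, sub_smul, one_smul]

theorem span_commutatorClass (hk : IsCoprime (k 0) (d : ℤ)) :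
    Submodule.span (RingRd d)
      (Set.range fun i : Fin n => commutatorClass k d (FreeGroup.of i.succ)) = ⊤ := by
  set N := Submodule.span (RingRd d)
    (Set.range fun i : Fin n => commutatorClass k d (FreeGroup.of i.succ))
  have hgen : ∀ s ∈ Set.range FreeGroup.of, commutatorClass k d s ∈ N := by
    rintro _ ⟨i, rfl⟩
    cases i using Fin.cases with
    | zero => rw [commutatorClass_of_zero]; exact N.zero_mem
    | succ i => exact Submodule.subset_span ⟨i, rfl⟩
  have hmem (x : FreeGroup (Fin (n + 1))) : commutatorClass k d x ∈ N :=
    (isCrossedHom_commutatorClass hk).map_mem_of_mem_closure hgen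
      (by rw [FreeGroup.closure_range_of]; trivial)
  rw [eq_top_iff, ← V0ni.span_range_of, Submodule.span_le]
  rintro _ ⟨x, rfl⟩
  rw [SetLike.mem_coe, ← Submodule.smul_mem_iff_of_isUnit N (isUnit_one_sub_qElt d)]
  exact commutatorClass_coe hk x.toMul ▸ hmem x.toMul

end CommutatorClass

/-! ### The isomorphism with the specialised Gassner representation -/

section GassnerEquiv

variable {n : ℕ} (k : Fin (n + 1) → ℤ) (d : ℕ) [NeZero d]

/-- The restriction of `crossedAt` to `K_0(k, d)`, where it is additive. -/
def crossedOnK0 : Additive (K0 k d) →+ (Fin n → RingRd d) :=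
  (isCrossedHom_crossedAt (qPoint k d)).restrict (K0 k d) fun _ hx => qChar_eq_one hx

variable {k d}

theorem crossedOnK0_conj (hk : IsCoprime (k 0) (d : ℤ)) (x : K0 k d) :
    crossedOnK0 k d (Additive.ofMul (MulAut.conjNormal (xi k d) x)) =
      qElt d • crossedOnK0 k d (Additive.ofMul x) := by
  rw [crossedOnK0, IsCrossedHom.restrict_apply, IsCrossedHom.restrict_apply, toMul_ofMul,
    toMul_ofMul, MulAut.conjNormal_apply,
    (isCrossedHom_crossedAt _).map_conj_of_eq_one _ (qChar_eq_one x.2), qChar_xi hk]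

/-- The map `V_0^{ni} → R_d^n` induced by `crossedAt`. -/
def toGassner (hk : IsCoprime (k 0) (d : ℤ)) : V0ni k d →ₗ[RingRd d] (Fin n → RingRd d) :=
  V0ni.lift (crossedOnK0 k d) (crossedOnK0_conj hk)

theorem toGassner_of (hk : IsCoprime (k 0) (d : ℤ)) (x : K0 k d) :
    toGassner hk (V0ni.of k d (Additive.ofMul x)) = crossedAt (qPoint k d) x :=
  V0ni.lift_of _ (crossedOnK0_conj hk) (Additive.ofMul x)

theorem crossedAt_xi : crossedAt (qPoint k d) (xi k d) = 0 := by
  have hS : ∀ s ∈ ({FreeGroup.of 0} : Set (FreeGroup (Fin (n + 1)))),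
      crossedAt (qPoint k d) s ∈ (⊥ : Submodule (RingRd d) (Fin n → RingRd d)) := by
    rintro _ rfl
    exact crossedAt_of_zero _
  exact (isCrossedHom_crossedAt (qPoint k d)).map_mem_of_mem_closure hS
    (pow_mem (Subgroup.mem_closure_singleton_self _) _)

theorem toGassner_commutatorClass (hk : IsCoprime (k 0) (d : ℤ)) (x : FreeGroup (Fin (n + 1))) :
    toGassner hk (commutatorClass k d x) = (1 - qElt d) • crossedAt (qPoint k d) x := by
  rw [commutatorClass, toGassner_of, (isCrossedHom_crossedAt _).map_commutator, crossedAt_xi,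
    smul_zero, sub_zero, qChar_xi hk]

theorem toGassner_homologyRep (hk : IsCoprime (k 0) (d : ℤ)) (p : pureBraidGroup n) :
    toGassner hk ∘ₗ homologyRep k d p =
      reducedGassnerAt (qPoint k d) p ∘ₗ toGassner hk := by
  refine LinearMap.ext_on_range (V0ni.span_range_of k d) fun x => ?_
  rw [LinearMap.comp_apply, LinearMap.comp_apply, ← ofMul_toMul x, V0ni.homologyRep_of,
    toGassner_of, toGassner_of, pureActionK0_coe, crossedAt_pureAction _ p (qChar_eq_one x.toMul.2)]

theorem toGassner_surjective (hk : ∀ i, IsCoprime (k i) (d : ℤ)) :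
    Function.Surjective (toGassner (hk 0)) := by
  refine LinearMap.range_eq_top.mp (eq_top_of_coordAt_vSub_mem (qPoint k d) fun i => ?_)
  have hq := isUnit_one_sub_qElt d
  have hqk := isUnit_one_sub_zpow (qUnit_pow d) hq (hk i)
  have himage : toGassner (hk 0) (commutatorClass k d (FreeGroup.of i)) =
      (1 - qElt d) • (1 - qPoint k d i : RingRd d) • coordAt (qPoint k d) (vSub i) := by
    rw [toGassner_commutatorClass, crossedAt_of]
  rw [← Submodule.smul_mem_iff_of_isUnit _ hqk, ← Submodule.smul_mem_iff_of_isUnit _ hq, ← himage]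
  exact LinearMap.mem_range_self _ _

/-- The isomorphism `V_0^{ni} ≅ R_d^n` of `R_d`-modules. -/
def gassnerEquiv (hk : ∀ i, IsCoprime (k i) (d : ℤ)) : V0ni k d ≃ₗ[RingRd d] (Fin n → RingRd d) :=
  LinearEquiv.ofBijective (toGassner (hk 0))
    (bijective_of_surjective_of_span_eq_top (toGassner_surjective hk) (span_commutatorClass (hk 0)))

/-- The isomorphism of `V_0^{ni}` with the reduced Gassner representation specialised at
`X_i ↦ q^{k_i}`. -/
def homologyRepEquiv (hk : ∀ i, IsCoprime (k i) (d : ℤ)) :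
    (homologyRep k d).Equiv (reducedGassnerAt (qPoint k d)) :=
  .mk (gassnerEquiv hk) (toGassner_homologyRep (hk 0))

end GassnerEquiv

/-! ### The decomposition over `ℚ` -/

section CyclotomicSum

/-- The isomorphism `R_d^n ≅ ⨁ E_e^n` over `ℚ`, coordinatewise `q ↦ (ω_e)_e`. -/
def cyclotomicSumEquiv (n d : ℕ) [NeZero d] : (Fin n → RingRd d) ≃ₗ[ℚ]
    DirectSum (NontrivDivisor d) fun e => Fin n → CyclotomicField (e : ℕ) ℚ :=
  (LinearEquiv.piCongrRight fun _ => (cyclotomicEquiv d).toLinearEquiv).trans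
    (((Equiv.piComm fun _ _ => _).toLinearEquiv ⟨fun _ _ => rfl, fun _ _ => rfl⟩).trans
    (DirectSum.linearEquivFunOnFintype ℚ (NontrivDivisor d)
      fun e => Fin n → CyclotomicField (e : ℕ) ℚ).symm)

theorem cyclotomicSumEquiv_apply {n d : ℕ} [NeZero d] (w : Fin n → RingRd d)
    (e : NontrivDivisor d) : cyclotomicSumEquiv n d w e = toCyclotomic e ∘ w := rfl

variable {n : ℕ} {k : Fin (n + 1) → ℤ} {d : ℕ} [NeZero d]

theorem toCyclotomic_comp_reducedGassnerAt (p : pureBraidGroup n) (w : Fin n → RingRd d)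
    (e : NontrivDivisor d) : toCyclotomic e ∘ reducedGassnerAt (qPoint k d) p w =
      gassnerAtRoot k (e : ℕ) p (toCyclotomic e ∘ w) := by
  have hpoint : (fun i => Units.map (toCyclotomic e).toRingHom.toMonoidHom (qPoint k d i)) =
      fun i => omegaUnit (e : ℕ) ^ k i := by
    funext i
    rw [map_zpow]
    congr 1
    exact Units.ext (toCyclotomic_qElt e)
  have hcomp := comp_reducedGassnerAt (qPoint k d) (toCyclotomic e).toRingHom p w
  rw [hpoint] at hcomp
  exact hcomp

/-- The isomorphism of `V_0^{ni}` with `⨁ g_n(k, e)` over `ℚ`. -/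
def homologyRepQEquiv (hk : ∀ i, IsCoprime (k i) (d : ℤ)) : (homologyRepQ k d).Equiv
    (Representation.directSum fun e : NontrivDivisor d => gassnerAtRoot k (e : ℕ)) :=
  .mk (((gassnerEquiv hk).restrictScalars ℚ).trans (cyclotomicSumEquiv n d)) fun p =>
    LinearMap.ext fun v => DFinsupp.ext fun e => by
      change cyclotomicSumEquiv n d ((toGassner (hk 0) ∘ₗ homologyRep k d p) v) e = _
      rw [toGassner_homologyRep, cyclotomicSumEquiv_apply]
      exact toCyclotomic_comp_reducedGassnerAt p _ e

theorem homologyRepQEquiv_smul (hk : ∀ i, IsCoprime (k i) (d : ℤ)) (r : RingRd d) (v : V0ni k d)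
    (e : NontrivDivisor d) :
    homologyRepQEquiv hk (r • v) e = toCyclotomic e r • homologyRepQEquiv hk v e := by
  change cyclotomicSumEquiv n d (gassnerEquiv hk (r • v)) e =
    toCyclotomic e r • cyclotomicSumEquiv n d (gassnerEquiv hk v) e
  ext i
  rw [map_smul, cyclotomicSumEquiv_apply, cyclotomicSumEquiv_apply, Function.comp_apply,
    Pi.smul_apply, Pi.smul_apply, smul_eq_mul, map_mul]
  rfl

end CyclotomicSum

end PureBraid

end

theorem mainTheorem5 (n d : ℕ) [NeZero d] (hd : 2 ≤ d) (k : Fin (n + 1) → ℤ)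
    (hk : ∀ i, IsCoprime (k i) (d : ℤ)) :
    (Module.Free (PureBraid.RingRd d) (PureBraid.V0ni k d) ∧
      Module.rank (PureBraid.RingRd d) (PureBraid.V0ni k d) = n) ∧
    Nonempty ((PureBraid.homologyRep k d).Equiv
      (PureBraid.reducedGassnerAt fun i => PureBraid.qUnit d ^ k i)) ∧
    ∃ Ψ : (PureBraid.homologyRepQ k d).Equiv
        (Representation.directSum fun e : PureBraid.NontrivDivisor d =>
          PureBraid.gassnerAtRoot k (e : ℕ)),
      ∀ (v : PureBraid.V0ni k d) (e : PureBraid.NontrivDivisor d),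
        Ψ (PureBraid.qElt d • v) e =
          PureBraid.omegaUnit (e : ℕ) • Ψ v e := by
  have := PureBraid.nontrivial_ringRd hd
  refine ⟨⟨Module.Free.of_equiv (PureBraid.gassnerEquiv hk).symm, ?_⟩,
    ⟨PureBraid.homologyRepEquiv hk⟩, PureBraid.homologyRepQEquiv hk, fun v e => ?_⟩
  · rw [(PureBraid.gassnerEquiv hk).rank_eq, rank_fun', Fintype.card_fin]
  · rw [PureBraid.homologyRepQEquiv_smul, PureBraid.toCyclotomic_qElt, Units.smul_def]
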